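/- Let $G$ be a connected $d$-regular graph on $N\ge 2$ vertices that is locally arc-transitive (for every vertex $u$ and any two neighbours $v_1,v_2$ of $u$ some automorphism of $G$ fixes $u$ and maps $v_1$ to $v_2$), and let $m$ be a vertex of $G$ (the unique marked vertex). Put $\ell=d/N$ and $s=1-\ell/d$. Lackadaisical walk. Fix for each vertex an ordering of its $d$ neighbours. On $\mathbb C^N\otimes\mathbb C^{d+1}$ with basis $|x,e_i\rangle$ $(1\le i\le d)$ and $|x,\circlearrowleft\rangle$, let $U=S\,(I\otimes C)\,\big((I-2|m\rangle\langle m|)\otimes I\big)$, where $C=2|c\rangle\langle c|-I$, $|c\rangle=\frac1{\sqrt{d+\ell}}\big(\sum_{i=1}^d|e_i\rangle+\sqrt\ell\,|\circlearrowleft\rangle\big)$, and $S|x,e_i\rangle=|y,e_j\rangle$ if $y$ is the $i$-th neighbour of $x$ and $x$ is the $j$-th neighbour of $y$, $S|x,\circlearrowleft\rangle=|x,\circlearrowleft\rangle$. Its initial state is $|init_{lazy}\rangle=\frac1{\sqrt{N-1}}\sum_{x\ne m}|x\rangle\otimes|c\rangle$. Quantum interpolated walk. Let $P$ be the random walk on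 $G$ ($P_{xy}=1/d$ if $y$ is a neighbour of $x$, and $0$ otherwise), $P'$ the walk obtained from $P$ by replacing all outgoing transitions of $m$ by a self-loop, $P(s)=(1-s)P+sP'$, and $|P(s)_x\rangle=\sum_y\sqrt{P(s)_{xy}}\,|y\rangle$. On $\mathbb C^N\otimes\mathbb C^N$ let $W(P(s))$ be the reflection about $\mathrm{span}\{|x\rangle\otimes|P(s)_x\rangle : x \text{ a vertex}\}$ followed by the swap of the two registers. Its initial state is $|init_{ip}\rangle=\frac1{\sqrt{N-1}}\sum_{x\ne m}|x\rangle\otimes|P(s)_x\rangle$. For a unitary $A$ and a state $|w\rangle$, the cotangent quantum hitting time is $\mathsf C(A,|w\rangle)=\sqrt{\sum|\langle\phi|w\rangle|^2\cot^2(\theta/2)}$, where the sum is over the members $|\phi\rangle$ of an orthonormal eigenbasis of $A$, $A|\phi\rangle=e^{i\theta}|\phi\rangle$, whose eigenvalue $e^{i\theta}$ is not $1$. Let $HT(P,\{m\})$ be the expected number of steps that the random walk $P$ needs to reach $m$ from a uniformly random vertex other than $m$; it is finite. Then $$\mathsf C\big(U,|init_{lazy}\rangle\big)^2=\frac{N+1}{N}\,\mathsf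 C\big(W(P(s)),|init_{ip}\rangle\big)^2+\frac1{2N-1},$$ and $$\mathsf C\big(W(P(s)),|init_{ip}\rangle\big)\in O\Big(\sqrt{HT(P,\{m\})}\Big),$$ where the constant in the $O$ is absolute (it depends neither on $G$, nor on $N$, $d$ or $m$). -/

import Mathlib

open scoped Kronecker

noncomputable section

namespace QWalk

/-! ### Quantum states and the cotangent quantum hitting time -/

/-- The Hilbert space spanned by the orthonormal basis `|i⟩`, `i : ι`. -/
abbrev Hilb (ι : Type*) [Fintype ι] : Type _ := EuclideanSpace ℂ ι

/-- The basis state `|i⟩`. -/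
def ket {ι : Type*} [Fintype ι] [DecidableEq ι] (i : ι) : Hilb ι :=
  EuclideanSpace.single i (1 : ℂ)

/-- The product state `|ψ⟩ ⊗ |φ⟩`, where the tensor product of the spaces spanned by `ι` and by
`κ` is the space spanned by `ι × κ`. -/
def tens {ι κ : Type*} [Fintype ι] [Fintype κ] (ψ : Hilb ι) (φ : Hilb κ) : Hilb (ι × κ) :=
  WithLp.toLp 2 fun p => ψ p.1 * φ p.2

/-- The rank-one operator `|ψ⟩⟨ψ|` as a matrix. -/
def ketBra {ι : Type*} [Fintype ι] (ψ : Hilb ι) : Matrix ι ι ℂ :=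
  Matrix.vecMulVec ψ.ofLp (star ψ.ofLp)

/-- The cotangent quantum hitting time of a quantum walk (a unitary operator) `U` on a state `w`:
the square root of the sum of `|⟨φ|w⟩|² cot²(θ/2)` over an orthonormal eigenbasis `φ` of `U`,
`U φ = e^{iθ} φ`, restricted to the eigenvalues `e^{iθ} ≠ 1`. The eigenvectors of one eigenvalue `μ`
are grouped together: they contribute the squared norm of the projection of `w` onto the eigenspace,
times `cot²(θ/2)` with `θ = arg μ`. -/
def cotQHT {ι : Type*} [Fintype ι] (U : Module.End ℂ (Hilb ι)) (w : Hilb ι) : ℝ :=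
  Real.sqrt (∑ᶠ μ ∈ {μ : ℂ | U.HasEigenvalue μ ∧ μ ≠ 1},
    ‖(U.eigenspace μ).starProjection w‖ ^ 2 * Real.cot (Complex.arg μ / 2) ^ 2)

/-! ### Random walks and hitting times -/

section Classical

variable {V : Type*} [Fintype V] [DecidableEq V]

/-- The random walk on `G`: move to a uniformly random neighbour. -/
def randomWalk (G : SimpleGraph V) [DecidableRel G.Adj] : Matrix V V ℝ :=
  Matrix.of fun x y => if G.Adj x y then 1 / (G.degree x : ℝ) else 0

/-- The absorbing walk `P'`: the outgoing transitions of the marked vertex `m` are replaced by a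
self-loop. -/
def absorbing (P : Matrix V V ℝ) (m : V) : Matrix V V ℝ :=
  Matrix.of fun x y => if x = m then (if y = m then 1 else 0) else P x y

/-- The interpolated walk `P(s) = (1 - s) P + s P'`. -/
def interpolated (P : Matrix V V ℝ) (m : V) (s : ℝ) : Matrix V V ℝ :=
  (1 - s) • P + s • absorbing P m

/-- The uniform distribution over all unmarked vertices. -/
def uniformUnmarked (m : V) (x : V) : ℝ :=
  if x = m then 0 else 1 / ((Fintype.card V : ℝ) - 1)

/-- The probability that the Markov chain with transition matrix `P` and initial distribution `ν`
follows the path `ω 0, ω 1, …, ω t`. -/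
def pathProb (P : Matrix V V ℝ) (ν : V → ℝ) {t : ℕ} (ω : Fin (t + 1) → V) : ℝ :=
  ν (ω 0) * ∏ i : Fin t, P (ω i.castSucc) (ω i.succ)

/-- The probability `Pr[τ > t]`, where `τ` is the first time at which the Markov chain with
transition matrix `P` and initial distribution `ν` is in `m`: the chain avoids `m` at the
times `0, …, t`. -/
def notHitProb (P : Matrix V V ℝ) (ν : V → ℝ) (m : V) (t : ℕ) : ℝ :=
  ∑ ω : Fin (t + 1) → V with ∀ i, ω i ≠ m, pathProb P ν ω

/-- The expectation `E[τ] = ∑ₜ Pr[τ > t]`, in `[0, ∞]`, of the first time `τ` at which the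
Markov chain with transition matrix `P` and initial distribution `ν` is in `m`. -/
def expectedHit (P : Matrix V V ℝ) (ν : V → ℝ) (m : V) : ENNReal :=
  ∑' t : ℕ, ENNReal.ofReal (notHitProb P ν m t)

/-- The hitting time `HT(P, {m})` of a random walk whose stationary distribution is uniform: the
expected number of steps to reach `m` from an unmarked vertex drawn from the stationary
distribution. -/
def hittingTime (P : Matrix V V ℝ) (m : V) : ENNReal :=
  expectedHit P (uniformUnmarked m) m

end Classical

/-! ### Quantum interpolated walks -/

section Interpolated

variable {V : Type*} [Fintype V] [DecidableEq V]

/-- The state `|P_x⟩ = ∑_y √P_{xy} |y⟩`. -/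
def rowState (P : Matrix V V ℝ) (x : V) : Hilb V :=
  ∑ y, (Real.sqrt (P x y) : ℂ) • ket y

/-- The subspace spanned by the states `|x, P_x⟩` for all vertices `x`. -/
def rowSpace (P : Matrix V V ℝ) : Submodule ℂ (Hilb (V × V)) :=
  Submodule.span ℂ (Set.range fun x => tens (ket x) (rowState P x))

/-- The operator that swaps the two registers. -/
def swapOp : Module.End ℂ (Hilb (V × V)) :=
  Matrix.toEuclideanLin (Matrix.of fun p q : V × V => if p = q.swap then (1 : ℂ) else 0)

/-- Szegedy's quantum walk of `P`: the reflection about the row space, followed by the swap. -/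
def szegedy (P : Matrix V V ℝ) : Module.End ℂ (Hilb (V × V)) :=
  swapOp * (rowSpace P).reflection.toLinearMap

/-- The quantum interpolated walk `W(P(s))`. -/
def interpolatedWalk (P : Matrix V V ℝ) (m : V) (s : ℝ) : Module.End ℂ (Hilb (V × V)) :=
  szegedy (interpolated P m s)

/-- The initial state of the quantum interpolated walk,
`(N - 1)^{-1/2} ∑_{x ≠ m} |x⟩ ⊗ |P(s)_x⟩`. -/
def interpolatedInit (P : Matrix V V ℝ) (m : V) (s : ℝ) : Hilb (V × V) :=
  ((1 / Real.sqrt ((Fintype.card V : ℝ) - 1) : ℝ) : ℂ) •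
    ∑ x with x ≠ m, tens (ket x) (rowState (interpolated P m s) x)

end Interpolated

/-! ### Lackadaisical quantum walks -/

section Lackadaisical

/-- The basis of the coin space: `some i` is the `i`-th outgoing arc `e_i`, and `none` is the
self-loop. -/
abbrev Coin (d : ℕ) : Type := Option (Fin d)

/-- The state `|c⟩ = (d + ℓ)^{-1/2} (|e_1⟩ + ⋯ + |e_d⟩ + √ℓ |↺⟩)`. -/
def coinState (d : ℕ) (l : ℝ) : Hilb (Coin d) :=
  ((1 / Real.sqrt (d + l) : ℝ) : ℂ) •
    ((∑ i : Fin d, ket (some i : Coin d)) + (Real.sqrt l : ℂ) • ket (none : Coin d))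

/-- The diffusion coin `C = 2 |c⟩⟨c| - I`. -/
def coinOp (d : ℕ) (l : ℝ) : Matrix (Coin d) (Coin d) ℂ :=
  (2 : ℂ) • ketBra (coinState d l) - 1

variable {V : Type*} [Fintype V] [DecidableEq V] {G : SimpleGraph V} {d : ℕ}

/-- Given an ordering `nbr x` of the neighbours of each vertex `x`, reverse an arc: `(x, e_i)` is
sent to `(y, e_j)`, where `y` is the `i`-th neighbour of `x`, and `x` is the `j`-th neighbour
of `y`. Self-loops are fixed. -/
def flipArc (nbr : (x : V) → Fin d ≃ G.neighborSet x) : V × Coin d → V × Coin d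
  | (x, some i) => ((nbr x i : V), some ((nbr (nbr x i : V)).symm ⟨x, (nbr x i).2.symm⟩))
  | (x, none) => (x, none)

/-- The flip-flop shift operator. -/
def shiftOp (nbr : (x : V) → Fin d ≃ G.neighborSet x) :
    Matrix (V × Coin d) (V × Coin d) ℂ :=
  Matrix.of fun p q => if p = flipArc nbr q then 1 else 0

/-- The query `(I - 2 |m⟩⟨m|) ⊗ I` to the oracle. -/
def queryOp (d : ℕ) (m : V) : Matrix (V × Coin d) (V × Coin d) ℂ :=
  ((1 : Matrix V V ℂ) - (2 : ℂ) • ketBra (ket m)) ⊗ₖ (1 : Matrix (Coin d) (Coin d) ℂ)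

/-- The lackadaisical quantum walk `S (I ⊗ C) G` with self-loops of weight `l`. -/
def lackadaisicalWalk (nbr : (x : V) → Fin d ≃ G.neighborSet x) (l : ℝ) (m : V) :
    Module.End ℂ (Hilb (V × Coin d)) :=
  Matrix.toEuclideanLin
    ((shiftOp nbr * ((1 : Matrix V V ℂ) ⊗ₖ coinOp d l)) * queryOp d m)

/-- The initial state of the lackadaisical quantum walk, `(N - 1)^{-1/2} ∑_{x ≠ m} |x⟩ ⊗ |c⟩`. -/
def lackadaisicalInit (d : ℕ) (l : ℝ) (m : V) : Hilb (V × Coin d) :=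
  ((1 / Real.sqrt ((Fintype.card V : ℝ) - 1) : ℝ) : ℂ) •
    ∑ x with x ≠ m, tens (ket x) (coinState d l)

end Lackadaisical

/-- A graph is locally arc-transitive if for any vertex `u` with neighbours `v₁` and `v₂`, some
automorphism maps the arc `(u, v₁)` to the arc `(u, v₂)`. -/
def LocallyArcTransitive {V : Type*} (G : SimpleGraph V) : Prop :=
  ∀ u v₁ v₂ : V, G.Adj u v₁ → G.Adj u v₂ → ∃ σ : G ≃g G, σ u = u ∧ σ v₁ = v₂

end QWalk

end

/-!
Write `N` for the number of vertices, and let `h x` be the expected hitting time of `m` from `x`.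

Both walks are products `S R` of an involution `S` that reverses arcs and a reflection `R`. By the
Cayley transform, `cot (θ / 2)` is up to a phase `(1 + μ) / (1 - μ)` at `μ = exp (i θ)`, so if
`w = w₀ + (1 - U) v` with `U w₀ = w₀` and `(1 + U) v` is orthogonal to the fixed vectors of `U`,
then the squared cotangent hitting time is `‖(1 + U) v‖²` (`cotQHT_sq_eq_norm_sq`). For `U = S R`
such a `v` comes from an electric flow: an antisymmetric `g` with the sources prescribed by
`w₁ = w - w₀` and orthogonal to all circulations. The result is `‖g‖² - ‖w₁‖²`
(`cotQHT_sq_eq_energy`).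

For both walks the flow is a multiple of the gradient of `h` on the arcs of `G`, because `h`
satisfies the potential equation with a constant source at every unmarked vertex. Summation by
parts turns its energy into `2 d ∑ h`, that is `2 d (N - 1) HT`. In the interpolated walk the
equation at `m` only involves the total current. In the lackadaisical walk the reflection at `m` is
about the complement of the coin state, so the same current must arrive on every arc at `m`; local
arc-transitivity guarantees this, since `h` is invariant under the automorphisms that fix `m`
(`IsHittingPotential.eq_of_adj`). Hence

* `C(W(P(s)))² = 2 N² HT / (2 N - 1)² - N / (2 N - 1)`,
* `C(U)² = 2 N (N + 1) HT / (2 N - 1)² - N / (2 N - 1)`,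

which gives the identity, and the bound with constant `1` because `2 N² ≤ (2 N - 1)²` for `N ≥ 2`.
The hitting time, given as the sum of the probabilities `Pr[τ > t]`, is computed from the linear
equations of `h` by telescoping (`expectedHit_eq`).
-/

open scoped Kronecker

noncomputable section

namespace QWalk

/-! ### Spectral decomposition of unitary operators -/

section Spectral

variable {E : Type*} [NormedAddCommGroup E] [InnerProductSpace ℂ E]
  {U : Module.End ℂ E}

theorem inner_map_map_of_norm_map (hU : ∀ x, ‖U x‖ = ‖x‖) (x y : E) :
    inner ℂ (U x) (U y) = inner ℂ x y :=
  (LinearIsometry.mk U hU).inner_map_map x y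

theorem norm_eigenvalue_eq_one (hU : ∀ x, ‖U x‖ = ‖x‖) {μ : ℂ} (hμ : U.HasEigenvalue μ) :
    ‖μ‖ = 1 := by
  obtain ⟨x, hx⟩ := hμ.exists_hasEigenvector
  have h := hU x
  rw [hx.apply_eq_smul, norm_smul] at h
  exact mul_right_cancel₀ (norm_ne_zero_iff.2 hx.2) (h.trans (one_mul _).symm)

/-- An isometry preserves the orthogonal complement of each of its eigenspaces. -/
theorem inner_map_eq_zero_of_mem_eigenspace (hU : ∀ x, ‖U x‖ = ‖x‖) {μ : ℂ} (hμ : ‖μ‖ = 1)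
    {k y : E} (hk : U k = μ • k) (hy : inner ℂ k y = 0) : inner ℂ k (U y) = 0 := by
  have h := inner_map_map_of_norm_map hU k y
  rw [hk, inner_smul_left, hy] at h
  have hμ0 : μ ≠ 0 := norm_ne_zero_iff.1 (by rw [hμ]; exact one_ne_zero)
  exact (mul_eq_zero.1 h).resolve_left (by simpa using hμ0)

theorem orthogonalFamily_eigenspaces_of_norm_map (hU : ∀ x, ‖U x‖ = ‖x‖) :
    OrthogonalFamily ℂ (fun μ : U.Eigenvalues => U.eigenspace μ)
      fun μ => (U.eigenspace μ).subtypeₗᵢ := by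
  rintro ⟨μ, hμ⟩ ⟨ν, hν⟩ hne ⟨x, hx⟩ ⟨y, hy⟩
  rw [Module.End.mem_eigenspace_iff] at hx hy
  have h := inner_map_map_of_norm_map hU x y
  change U x = μ • x at hx
  change U y = ν • y at hy
  rw [hx, hy, inner_smul_left, inner_smul_right, ← mul_assoc] at h
  by_contra h0
  change inner ℂ x y ≠ 0 at h0
  have h1 : (starRingEnd ℂ) μ * ν = 1 := mul_right_cancel₀ h0 (h.trans (one_mul _).symm)
  have h2 : (starRingEnd ℂ) μ * μ = 1 := by
    rw [mul_comm, Complex.mul_conj, Complex.normSq_eq_norm_sq, norm_eigenvalue_eq_one hU hμ]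
    simp
  have h3 : (starRingEnd ℂ) μ ≠ 0 := fun h => by simp [h] at h2
  exact hne (Subtype.ext (mul_left_cancel₀ h3 (h2.trans h1.symm)))

/-- The eigenspaces of an isometry of a finite-dimensional space span: on the orthogonal complement
of their span, which is invariant, there would be another eigenvector. -/
theorem iSup_eigenspaces_eq_top [FiniteDimensional ℂ E] (hU : ∀ x, ‖U x‖ = ‖x‖) :
    ⨆ μ : U.Eigenvalues, U.eigenspace μ = ⊤ := by
  rw [← Submodule.orthogonal_eq_bot_iff]
  set K : Submodule ℂ E := (⨆ μ : U.Eigenvalues, U.eigenspace μ)ᗮ with hK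
  have hinv : ∀ y ∈ K, U y ∈ K := by
    intro y hy
    rw [hK, ← Submodule.iInf_orthogonal, Submodule.mem_iInf] at hy ⊢
    rintro ⟨μ, hμ⟩ k hk
    exact inner_map_eq_zero_of_mem_eigenspace hU (norm_eigenvalue_eq_one hU hμ)
      (Module.End.mem_eigenspace_iff.1 hk) (hy ⟨μ, hμ⟩ k hk)
  by_contra hne
  have : Nontrivial K := Submodule.nontrivial_iff_ne_bot.2 hne
  obtain ⟨μ, hμ⟩ := Module.End.exists_eigenvalue (U.restrict hinv)
  obtain ⟨⟨x, hxK⟩, hx⟩ := hμ.exists_hasEigenvector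
  have hUx : U x = μ • x := congrArg Subtype.val hx.apply_eq_smul
  have hx0 : x ≠ 0 := fun h => hx.2 (Subtype.ext h)
  have hμ' : U.HasEigenvalue μ :=
    Module.End.hasEigenvalue_of_hasEigenvector ⟨Module.End.mem_eigenspace_iff.2 hUx, hx0⟩
  have h := hxK
  rw [hK, ← Submodule.iInf_orthogonal, Submodule.mem_iInf] at h
  exact hx0 (inner_self_eq_zero.1 (h ⟨μ, hμ'⟩ x (Module.End.mem_eigenspace_iff.2 hUx)))

theorem starProjection_eigenspace_map [FiniteDimensional ℂ E] (hU : ∀ x, ‖U x‖ = ‖x‖) {μ : ℂ}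
    (hμ : ‖μ‖ = 1) (v : E) :
    (U.eigenspace μ).starProjection (U v) = μ • (U.eigenspace μ).starProjection v := by
  refine Submodule.eq_starProjection_of_mem_orthogonal
    (Submodule.smul_mem _ _ (Submodule.starProjection_apply_mem _ _)) ?_
  have h : U ((U.eigenspace μ).starProjection v) = μ • (U.eigenspace μ).starProjection v :=
    Module.End.mem_eigenspace_iff.1 (Submodule.starProjection_apply_mem _ _)
  rw [← h, ← map_sub, Submodule.mem_orthogonal]
  intro k hk
  exact inner_map_eq_zero_of_mem_eigenspace hU hμ (Module.End.mem_eigenspace_iff.1 hk)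
    (Submodule.inner_right_of_mem_orthogonal hk (Submodule.sub_starProjection_mem_orthogonal v))

theorem sum_norm_sq_starProjection_eigenspace [FiniteDimensional ℂ E]
    (hU : ∀ x, ‖U x‖ = ‖x‖) (z : E) :
    ∑ μ : U.Eigenvalues, ‖(U.eigenspace μ).starProjection z‖ ^ 2 = ‖z‖ ^ 2 := by
  have hV := orthogonalFamily_eigenspaces_of_norm_map hU
  have hsum := hV.sum_projection_of_mem_iSup z (by rw [iSup_eigenspaces_eq_top hU]; trivial)
  have h := hV.norm_sum (fun μ => (U.eigenspace μ).orthogonalProjectionOnto z) Finset.univ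
  conv_rhs => rw [← hsum]
  exact h.symm

end Spectral

/-- `cot (θ / 2)` is, up to the factor `i`, the Cayley transform `(1 + μ) / (1 - μ)` of
`μ = exp (i θ)`. -/
theorem cot_half_arg_sq_mul {μ : ℂ} (hμ : ‖μ‖ = 1) (h1 : μ ≠ 1) :
    Real.cot (Complex.arg μ / 2) ^ 2 * ‖1 - μ‖ ^ 2 = ‖1 + μ‖ ^ 2 := by
  have hre : μ.re = Real.cos μ.arg := by
    rw [Complex.cos_arg (norm_ne_zero_iff.1 (by rw [hμ]; exact one_ne_zero)), hμ, div_one]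
  have hn : μ.re ^ 2 + μ.im ^ 2 = 1 := by
    have h := Complex.sq_norm μ
    rw [hμ, Complex.normSq_apply] at h
    linarith
  have hcos : Real.cos μ.arg = 2 * Real.cos (μ.arg / 2) ^ 2 - 1 := by
    rw [← Real.cos_two_mul]; congr 1; ring
  have hsc := Real.sin_sq_add_cos_sq (μ.arg / 2)
  have hm : ‖1 - μ‖ ^ 2 = 4 * Real.sin (μ.arg / 2) ^ 2 := by
    rw [Complex.sq_norm, Complex.normSq_apply]
    simp only [Complex.sub_re, Complex.sub_im, Complex.one_re, Complex.one_im]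
    nlinarith
  have hp : ‖1 + μ‖ ^ 2 = 4 * Real.cos (μ.arg / 2) ^ 2 := by
    rw [Complex.sq_norm, Complex.normSq_apply]
    simp only [Complex.add_re, Complex.add_im, Complex.one_re, Complex.one_im]
    nlinarith
  have hs : Real.sin (μ.arg / 2) ≠ 0 := by
    intro h0
    rw [h0] at hm
    have : ‖1 - μ‖ = 0 := by simpa using hm
    exact h1 (sub_eq_zero.1 (norm_eq_zero.1 this)).symm
  rw [hm, hp, Real.cot_eq_cos_div_sin]
  field_simp

/-! ### The cotangent hitting time as an energy -/

/-- Up to a fixed vector, `w` is `(1 - U) v`; the Cayley transform turns it into `(1 + U) v`, whose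
norm is the cotangent hitting time as soon as the eigenvalue `1` does not contribute to it. -/
theorem cotQHT_sq_eq_norm_sq {ι : Type*} [Fintype ι] {U : Module.End ℂ (Hilb ι)}
    (hU : ∀ x, ‖U x‖ = ‖x‖) {w w₀ v : Hilb ι} (hw₀ : U w₀ = w₀) (hw : w = w₀ + (v - U v))
    (hk : ∀ k, U k = k → inner ℂ k (v + U v) = 0) :
    cotQHT U w ^ 2 = ‖v + U v‖ ^ 2 := by
  rw [cotQHT, Real.sq_sqrt (finsum_nonneg fun μ => finsum_nonneg fun _ => by positivity)]
  have hterm : ∀ μ : U.Eigenvalues, (if (μ : ℂ) ≠ 1 then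
      ‖(U.eigenspace μ).starProjection w‖ ^ 2 * Real.cot (Complex.arg μ / 2) ^ 2 else 0)
      = ‖(U.eigenspace μ).starProjection (v + U v)‖ ^ 2 := by
    rintro ⟨μ, hμ⟩
    have hn := norm_eigenvalue_eq_one hU hμ
    change (if μ ≠ 1 then
      ‖(U.eigenspace μ).starProjection w‖ ^ 2 * Real.cot (Complex.arg μ / 2) ^ 2 else 0)
      = ‖(U.eigenspace μ).starProjection (v + U v)‖ ^ 2
    split_ifs with h1
    · have h0 : (U.eigenspace μ).starProjection w₀ = 0 := by
        have h := starProjection_eigenspace_map hU hn w₀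
        rw [hw₀] at h
        have h2 : (1 - μ) • (U.eigenspace μ).starProjection w₀ = 0 := by
          rw [sub_smul, one_smul, ← h, sub_self]
        exact (smul_eq_zero.1 h2).resolve_left (sub_ne_zero.2 (Ne.symm h1))
      have hP : (U.eigenspace μ).starProjection w
          = (1 - μ) • (U.eigenspace μ).starProjection v := by
        rw [hw, map_add, map_sub, starProjection_eigenspace_map hU hn, h0, zero_add, sub_smul,
          one_smul]
      have hQ : (U.eigenspace μ).starProjection (v + U v)
          = (1 + μ) • (U.eigenspace μ).starProjection v := by
        rw [map_add, starProjection_eigenspace_map hU hn, add_smul, one_smul]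
      rw [hP, hQ, norm_smul, norm_smul, mul_pow, mul_pow, ← cot_half_arg_sq_mul hn h1]
      ring
    · rw [not_not] at h1
      subst h1
      have : (U.eigenspace 1).starProjection (v + U v) = 0 := by
        rw [Submodule.starProjection_apply_eq_zero_iff, Submodule.mem_orthogonal]
        intro k hk'
        exact hk k (by simpa using Module.End.mem_eigenspace_iff.1 hk')
      rw [this]
      simp
  rw [← sum_norm_sq_starProjection_eigenspace hU, ← Finset.sum_congr rfl fun μ _ => hterm μ,
    ← finsum_eq_sum_of_fintype]
  refine Eq.trans ?_ (finsum_mem_range (f := fun μ : ℂ => if μ ≠ 1 then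
      ‖(U.eigenspace μ).starProjection w‖ ^ 2 * Real.cot (Complex.arg μ / 2) ^ 2 else 0)
    (g := (Subtype.val : U.Eigenvalues → ℂ)) Subtype.val_injective)
  refine finsum_congr fun μ => ?_
  by_cases hμ : U.HasEigenvalue μ <;> by_cases h1 : μ = 1 <;> simp [hμ, h1]

/-- The electric-flow formula for a product `S R` of two involutive isometries. The part `w₀` of
the initial state is fixed by both. If `g` is `S`-antisymmetric (a flow), has the remaining part
`w₁` as its projection to the `1`-eigenspace of `R` (it has the prescribed sources), and is
orthogonal to all circulations (it is a potential flow), then the squared cotangent hitting time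
is the energy of `g` minus `‖w₁‖²`. -/
theorem cotQHT_sq_eq_energy {ι : Type*} [Fintype ι] {S R : Module.End ℂ (Hilb ι)}
    (hS : ∀ x, ‖S x‖ = ‖x‖) (hR : ∀ x, ‖R x‖ = ‖x‖) (hSS : ∀ x, S (S x) = x)
    (hRR : ∀ x, R (R x) = x) {w₀ w₁ g : Hilb ι} (hSw₀ : S w₀ = w₀) (hRw₀ : R w₀ = w₀)
    (hRw₁ : R w₁ = w₁) (hSg : S g = -g) (hRg : R (g - w₁) = -(g - w₁))
    (hcirc : ∀ b, S b = -b → R b = -b → inner ℂ b g = 0) :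
    cotQHT (S * R) (w₀ + w₁) ^ 2 = ‖g‖ ^ 2 - ‖w₁‖ ^ 2 := by
  have hRg' : R g = w₁ + w₁ - g := by
    rw [map_sub, hRw₁] at hRg
    rw [eq_add_of_sub_eq hRg]; abel
  -- A vector fixed by `R` is orthogonal to a vector negated by `R`.
  have hort : ∀ {x y : Hilb ι}, R x = x → R y = -y → inner ℂ x y = 0 := by
    intro x y hx hy
    have h := inner_map_map_of_norm_map hR x y
    rw [hx, hy, inner_neg_right] at h
    exact self_eq_neg.1 h.symm
  set v : Hilb ι := w₁ - (2⁻¹ : ℂ) • g with hv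
  have hRv : R v = (2⁻¹ : ℂ) • g := by
    rw [hv, map_sub, map_smul, hRw₁, hRg']
    module
  have hUv : (S * R) v = -((2⁻¹ : ℂ) • g) := by
    rw [Module.End.mul_apply, hRv, map_smul, hSg, smul_neg]
  have hz : v + (S * R) v = -(g - w₁) := by
    rw [hUv, hv]; module
  rw [cotQHT_sq_eq_norm_sq (w₀ := w₀) (v := v) (fun x => by rw [Module.End.mul_apply, hS, hR])
    (by rw [Module.End.mul_apply, hRw₀, hSw₀]) (by rw [hUv, hv]; module), hz, norm_neg]
  · have h0 := hort hRw₁ hRg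
    have h := norm_add_sq_eq_norm_sq_add_norm_sq_of_inner_eq_zero w₁ (g - w₁) h0
    rw [add_sub_cancel] at h
    nlinarith
  · intro k hk
    rw [Module.End.mul_apply] at hk
    have hSk : S k = R k := by rw [← hSS (R k), hk]
    have hSRk : S (R k) = k := hk
    -- The fixed vectors of `S R` split into symmetric ones in the `1`-eigenspace of `R` and
    -- antisymmetric ones in its `-1`-eigenspace.
    have hk2 : k = (2⁻¹ : ℂ) • (k + R k) + (2⁻¹ : ℂ) • (k - R k) := by module
    have ha : inner ℂ (k + R k) (g - w₁) = 0 :=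
      hort (by rw [map_add, hRR, add_comm]) hRg
    have hbR : R (k - R k) = -(k - R k) := by rw [map_sub, hRR]; abel
    have hbS : S (k - R k) = -(k - R k) := by rw [map_sub, hSRk, hSk]; abel
    have hb1 : inner ℂ (k - R k) w₁ = 0 := by
      rw [← inner_conj_symm, hort hRw₁ hbR, map_zero]
    have hbg := hcirc _ hbS hbR
    rw [hz, hk2, inner_neg_right, inner_add_left, inner_smul_left, inner_smul_left, ha,
      inner_sub_right (k - R k), hb1, hbg]
    simp

/-! ### Potentials on graphs -/

section Potential

variable {V : Type*} [Fintype V] {G : SimpleGraph V} [DecidableRel G.Adj]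

/-- Summation by parts: the pairing of a flow `k` with the gradient of `f`. -/
theorem sum_flow_mul_gradient {A : Type*} [CommRing A] (k : V → V → A)
    (hk : ∀ x y, G.Adj x y → k y x = -k x y) (f : V → A) :
    ∑ x, ∑ y ∈ G.neighborFinset x, k x y * (f x - f y)
      = 2 * ∑ x, f x * ∑ y ∈ G.neighborFinset x, k x y := by
  have h1 : ∑ x, ∑ y ∈ G.neighborFinset x, k x y * f y
      = -∑ x, ∑ y ∈ G.neighborFinset x, k x y * f x := by
    simp only [SimpleGraph.neighborFinset_eq_filter, Finset.sum_filter]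
    rw [Finset.sum_comm, ← Finset.sum_neg_distrib]
    refine Finset.sum_congr rfl fun x _ => ?_
    rw [← Finset.sum_neg_distrib]
    refine Finset.sum_congr rfl fun y _ => ?_
    by_cases h : G.Adj x y
    · rw [if_pos h, if_pos h.symm, hk x y h, neg_mul]
    · rw [if_neg h, if_neg fun h' => h h'.symm, neg_zero]
  simp only [mul_sub, Finset.sum_sub_distrib]
  rw [h1, sub_neg_eq_add, ← two_mul]
  congr 1
  refine Finset.sum_congr rfl fun x _ => ?_
  rw [Finset.mul_sum]
  exact Finset.sum_congr rfl fun y _ => mul_comm _ _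

/-- A circulation, that is an antisymmetric vector with zero divergence at every vertex, is
orthogonal to every gradient. -/
theorem circulation_mul_gradient_eq_zero {k : V → V → ℂ}
    (hk : ∀ x y, G.Adj x y → k y x = -k x y)
    (hdiv : ∀ x, ∑ y ∈ G.neighborFinset x, k x y = 0) (f : V → ℂ) :
    ∑ x, ∑ y ∈ G.neighborFinset x, k x y * (f x - f y) = 0 := by
  rw [sum_flow_mul_gradient k hk f, Finset.sum_eq_zero fun x _ => by rw [hdiv x, mul_zero],
    mul_zero]

/-- A function that vanishes at `m` and is harmonic elsewhere has Dirichlet energy `0`, so it is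
constant. -/
theorem eq_zero_of_harmonic (hG : G.Connected) {m : V} {f : V → ℝ} (hm : f m = 0)
    (hf : ∀ x, x ≠ m → ∑ y ∈ G.neighborFinset x, (f x - f y) = 0) : f = 0 := by
  have hE := sum_flow_mul_gradient (G := G) (fun x y => f x - f y) (fun x y _ => by ring) f
  have h0 : ∑ x, f x * ∑ y ∈ G.neighborFinset x, (f x - f y) = 0 := by
    refine Finset.sum_eq_zero fun x _ => ?_
    by_cases hx : x = m
    · rw [hx, hm, zero_mul]
    · rw [hf x hx, mul_zero]
  rw [h0, mul_zero] at hE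
  have hadj : ∀ x y, G.Adj x y → f x = f y := by
    intro x y hxy
    have h1 := (Finset.sum_eq_zero_iff_of_nonneg (fun x _ => Finset.sum_nonneg fun y _ =>
      mul_self_nonneg (f x - f y))).1 hE x (Finset.mem_univ x)
    have h2 := (Finset.sum_eq_zero_iff_of_nonneg (fun y _ =>
      mul_self_nonneg (f x - f y))).1 h1 y (by simpa using hxy)
    exact sub_eq_zero.1 (mul_self_eq_zero.1 h2)
  have hwalk : ∀ x y, G.Walk x y → f x = f y := by
    intro x y p
    induction p with
    | nil => rfl
    | cons h _ ih => exact (hadj _ _ h).trans ih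
  funext x
  obtain ⟨p⟩ := hG.preconnected x m
  exact (hwalk x m p).trans hm

/-- `h x` is the expected number of steps from `x` to `m` of the random walk on a `d`-regular
graph, described by its linear equations. Divided by `d`, it is the electric potential when each
unmarked vertex injects a unit current and all the current leaves at `m`. -/
structure IsHittingPotential (G : SimpleGraph V) [DecidableRel G.Adj] (d : ℕ) (m : V)
    (h : V → ℝ) : Prop where
  marked : h m = 0
  unmarked : ∀ x, x ≠ m → ∑ y ∈ G.neighborFinset x, (h x - h y) = d

theorem IsHittingPotential.unique (hG : G.Connected) {d : ℕ} {m : V} {h h' : V → ℝ}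
    (hh : IsHittingPotential G d m h) (hh' : IsHittingPotential G d m h') : h = h' := by
  refine sub_eq_zero.1 (eq_zero_of_harmonic (m := m) hG ?_ fun x hx => ?_)
  · rw [Pi.sub_apply, hh.marked, hh'.marked, sub_zero]
  · simp only [Pi.sub_apply, sub_sub_sub_comm]
    rw [Finset.sum_sub_distrib, hh.unmarked x hx, hh'.unmarked x hx, sub_self]

theorem exists_isHittingPotential (hG : G.Connected) (d : ℕ) (m : V) :
    ∃ h, IsHittingPotential G d m h := by
  classical
  let T : (V → ℝ) →ₗ[ℝ] (V → ℝ) :=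
    { toFun := fun f x => if x = m then f x else ∑ y ∈ G.neighborFinset x, (f x - f y)
      map_add' := fun f g => by
        funext x
        simp only [Pi.add_apply, add_sub_add_comm, Finset.sum_add_distrib]
        split_ifs <;> rfl
      map_smul' := fun c f => by
        funext x
        simp only [Pi.smul_apply, smul_eq_mul, ← mul_sub, ← Finset.mul_sum, RingHom.id_apply]
        split_ifs <;> rfl }
  have hT : ∀ f x, T f x = if x = m then f x else ∑ y ∈ G.neighborFinset x, (f x - f y) :=
    fun f x => rfl
  have hinj : Function.Injective T := by
    rw [← LinearMap.ker_eq_bot, LinearMap.ker_eq_bot']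
    intro f hf
    refine eq_zero_of_harmonic hG (m := m) ?_ fun x hx => ?_
    · simpa [hT] using congrFun hf m
    · simpa [hT, hx] using congrFun hf x
  obtain ⟨h, hh⟩ := LinearMap.injective_iff_surjective.1 hinj fun x => if x = m then 0 else d
  refine ⟨h, ?_, fun x hx => ?_⟩
  · simpa [hT] using congrFun hh m
  · simpa [hT, hx] using congrFun hh x

namespace IsHittingPotential

variable {d : ℕ} {m : V} {h : V → ℝ}

/-- A negative minimum would be attained at an unmarked vertex, where the current cannot flow
out. -/
theorem nonneg (hd : 0 < d) (hh : IsHittingPotential G d m h) (x : V) : 0 ≤ h x := by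
  have : Nonempty V := ⟨x⟩
  obtain ⟨z, hz⟩ := Finite.exists_min h
  refine le_trans ?_ (hz x)
  by_cases hzm : z = m
  · rw [hzm, hh.marked]
  · have h1 := hh.unmarked z hzm
    have h2 : ∑ y ∈ G.neighborFinset z, (h z - h y) ≤ 0 :=
      Finset.sum_nonpos fun y _ => sub_nonpos.2 (hz y)
    rw [h1] at h2
    exact absurd h2 (not_le.2 (by exact_mod_cast hd))

theorem sum_marked (hh : IsHittingPotential G d m h) :
    ∑ y ∈ G.neighborFinset m, (h m - h y) = -(d * ((Fintype.card V : ℝ) - 1)) := by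
  classical
  have h0 := sum_flow_mul_gradient (G := G) (fun x y => h x - h y) (fun x y _ => by ring)
    (fun _ => (1 : ℝ))
  simp only [sub_self, mul_zero, Finset.sum_const_zero, one_mul] at h0
  rw [← Finset.add_sum_erase _ _ (Finset.mem_univ m)] at h0
  rw [Finset.sum_congr rfl fun x hx => hh.unmarked x (Finset.ne_of_mem_erase hx),
    Finset.sum_const, Finset.card_erase_of_mem (Finset.mem_univ m), Finset.card_univ,
    nsmul_eq_mul, Nat.cast_sub (Fintype.card_pos_iff.2 ⟨m⟩)] at h0
  push_cast at h0
  linarith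

theorem comp_iso (hh : IsHittingPotential G d m h) (σ : G ≃g G) (hσ : σ m = m) :
    IsHittingPotential G d m (h ∘ σ) where
  marked := by rw [Function.comp_apply, hσ, hh.marked]
  unmarked x hx := by
    have hx' : σ x ≠ m := fun e => hx (σ.injective (e.trans hσ.symm))
    rw [← hh.unmarked (σ x) hx']
    refine Finset.sum_equiv σ.toEquiv (fun y => ?_) fun y _ => rfl
    simp only [SimpleGraph.mem_neighborFinset]
    exact σ.map_adj_iff.symm

/-- All neighbours of `m` have the same expected hitting time, as they are conjugate under
automorphisms that fix `m`. Its value is forced by the total current. -/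
theorem eq_of_adj (hG : G.Connected) (hd : G.IsRegularOfDegree d)
    (hA : LocallyArcTransitive G) (hh : IsHittingPotential G d m h) {y : V} (hy : G.Adj m y) :
    h y = (Fintype.card V : ℝ) - 1 := by
  have hconst : ∀ z ∈ G.neighborFinset m, h m - h z = -h y := by
    intro z hz
    obtain ⟨σ, hσ, hσz⟩ := hA m y z hy (by simpa using hz)
    have h1 := congrFun ((hh.comp_iso σ hσ).unique hG hh) y
    rw [Function.comp_apply, hσz] at h1
    rw [hh.marked, h1, zero_sub]
  have h1 := hh.sum_marked
  rw [Finset.sum_congr rfl hconst, Finset.sum_const, G.card_neighborFinset_eq_degree, hd m,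
    nsmul_eq_mul] at h1
  have hd0 : (d : ℝ) ≠ 0 := by
    have h2 : 0 < G.degree m := (G.degree_pos_iff_exists_adj m).2 ⟨y, hy⟩
    rw [hd m] at h2
    exact_mod_cast h2.ne'
  have h2 : (d : ℝ) * h y = d * ((Fintype.card V : ℝ) - 1) := by linarith
  exact mul_left_cancel₀ hd0 h2

/-- The Dirichlet energy of the potential is the total of the hitting times. -/
theorem energy (hh : IsHittingPotential G d m h) :
    ∑ x, ∑ y ∈ G.neighborFinset x, (h x - h y) ^ 2 = 2 * (d * ∑ x, h x) := by
  simp only [sq]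
  rw [sum_flow_mul_gradient (G := G) (fun x y => h x - h y) (fun x y _ => by ring) h]
  congr 1
  rw [Finset.mul_sum]
  refine Finset.sum_congr rfl fun x _ => ?_
  by_cases hx : x = m
  · rw [hx, hh.marked, zero_mul, mul_zero]
  · rw [hh.unmarked x hx, mul_comm]

end IsHittingPotential

end Potential

/-! ### Hitting times of Markov chains -/

section Hitting

variable {V : Type*} [Fintype V] [DecidableEq V]

/-- One step of the Markov chain `P` that is killed at `m`, applied to a measure `ν`. -/
def killedStep (P : Matrix V V ℝ) (m : V) (ν : V → ℝ) (y : V) : ℝ :=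
  ∑ x with x ≠ m, ν x * P x y

theorem killedStep_nonneg {P : Matrix V V ℝ} (hP : ∀ x y, 0 ≤ P x y) (m : V) {ν : V → ℝ}
    (hν : ∀ x, 0 ≤ ν x) (y : V) : 0 ≤ killedStep P m ν y :=
  Finset.sum_nonneg fun x _ => mul_nonneg (hν x) (hP x y)

theorem notHitProb_zero (P : Matrix V V ℝ) (ν : V → ℝ) (m : V) :
    notHitProb P ν m 0 = ∑ x with x ≠ m, ν x := by
  rw [notHitProb, Finset.sum_filter, Finset.sum_filter,
    ← (Equiv.funUnique (Fin 1) V).symm.sum_comp]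
  refine Finset.sum_congr rfl fun x _ => ?_
  simp [pathProb, Equiv.funUnique]

theorem notHitProb_succ (P : Matrix V V ℝ) (ν : V → ℝ) (m : V) (t : ℕ) :
    notHitProb P ν m (t + 1) = notHitProb P (killedStep P m ν) m t := by
  rw [notHitProb, notHitProb, Finset.sum_filter, Finset.sum_filter,
    ← (Fin.consEquiv fun _ : Fin (t + 2) => V).sum_comp, Fintype.sum_prod_type_right]
  refine Finset.sum_congr rfl fun ω _ => ?_
  simp only [pathProb, killedStep, Finset.sum_filter, Finset.sum_mul, Fin.consEquiv_apply]
  by_cases hω : ∀ i, ω i ≠ m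
  · rw [if_pos hω]
    refine Finset.sum_congr rfl fun x _ => ?_
    by_cases hx : x = m
    · rw [if_neg, if_neg (not_not.2 hx), zero_mul]
      exact fun hall => hall 0 (by simpa using hx)
    · rw [if_pos hx, if_pos]
      · rw [Fin.prod_univ_succ]
        simp [mul_assoc]
      · intro i
        refine Fin.cases ?_ (fun j => ?_) i
        · simpa using hx
        · simpa using hω j
  · rw [if_neg hω]
    refine Finset.sum_eq_zero fun x _ => if_neg fun hall => hω fun i => ?_
    simpa using hall i.succ

theorem notHitProb_nonneg {P : Matrix V V ℝ} (hP : ∀ x y, 0 ≤ P x y) (m : V) {ν : V → ℝ}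
    (hν : ∀ x, 0 ≤ ν x) (t : ℕ) : 0 ≤ notHitProb P ν m t :=
  Finset.sum_nonneg fun _ _ => mul_nonneg (hν _) (Finset.prod_nonneg fun _ _ => hP _ _)

/-- A nonnegative solution `h` of the hitting time equations controls the partial sums of
`∑ₜ Pr[τ > t]`: the error is the expectation of `h` at time `T` on survival. -/
theorem sum_notHitProb_add {P : Matrix V V ℝ} {m : V} {h : V → ℝ} (hm : h m = 0)
    (hh : ∀ x, x ≠ m → h x = 1 + ∑ y, P x y * h y) (T : ℕ) (ν : V → ℝ) :
    ∑ t ∈ Finset.range T, notHitProb P ν m t + ∑ x, (killedStep P m)^[T] ν x * h x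
      = ∑ x, ν x * h x := by
  induction T generalizing ν with
  | zero => simp
  | succ T ih =>
    rw [Finset.sum_range_succ', Function.iterate_succ_apply]
    simp only [notHitProb_succ]
    rw [add_right_comm, ih, notHitProb_zero]
    have h1 : ∑ y, killedStep P m ν y * h y
        = ∑ x with x ≠ m, ν x * ∑ y, P x y * h y := by
      simp only [killedStep, Finset.sum_mul, Finset.mul_sum]
      rw [Finset.sum_comm]
      simp only [mul_assoc]
    rw [h1, ← Finset.sum_add_distrib, Finset.sum_filter]
    refine Finset.sum_congr rfl fun x _ => ?_
    split_ifs with hx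
    · rw [hh x hx]; ring
    · rw [not_not.1 hx, hm, mul_zero]

theorem notHitProb_eq_iterate (P : Matrix V V ℝ) (ν : V → ℝ) (m : V) (T : ℕ) :
    notHitProb P ν m T = ∑ x with x ≠ m, (killedStep P m)^[T] ν x := by
  induction T generalizing ν with
  | zero => exact notHitProb_zero P ν m
  | succ T ih => rw [notHitProb_succ, ih, Function.iterate_succ_apply]

theorem expectedHit_eq {P : Matrix V V ℝ} (hP : ∀ x y, 0 ≤ P x y) {m : V} {h : V → ℝ}
    (hm : h m = 0) (h0 : ∀ x, 0 ≤ h x) (hh : ∀ x, x ≠ m → h x = 1 + ∑ y, P x y * h y)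
    {ν : V → ℝ} (hν : ∀ x, 0 ≤ ν x) :
    expectedHit P ν m = ENNReal.ofReal (∑ x, ν x * h x) := by
  have hit : ∀ T x, 0 ≤ (killedStep P m)^[T] ν x := by
    intro T
    induction T with
    | zero => exact hν
    | succ T ih =>
      rw [Function.iterate_succ_apply']
      exact killedStep_nonneg hP m ih
  have hnn := notHitProb_nonneg hP m hν
  have hsumm : Summable fun t => notHitProb P ν m t := by
    refine summable_of_sum_range_le (c := ∑ x, ν x * h x) hnn fun T => ?_
    rw [← sum_notHitProb_add hm hh T ν]
    exact le_add_of_nonneg_right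
      (Finset.sum_nonneg fun x _ => mul_nonneg (hit T x) (h0 x))
  -- The error term is at most `Pr[τ > T]` times the total of `h`.
  have hrest : Filter.Tendsto (fun T => ∑ x, (killedStep P m)^[T] ν x * h x) Filter.atTop
      (nhds 0) := by
    have hlim := hsumm.tendsto_atTop_zero.mul_const (∑ x, h x)
    rw [zero_mul] at hlim
    refine squeeze_zero (fun T => Finset.sum_nonneg fun x _ => mul_nonneg (hit T x) (h0 x))
      (fun T => ?_) hlim
    rw [notHitProb_eq_iterate, Finset.mul_sum]
    refine Finset.sum_le_sum fun x _ => ?_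
    by_cases hx : x = m
    · rw [hx, hm, mul_zero, mul_zero]
    · exact mul_le_mul_of_nonneg_right (Finset.single_le_sum (fun y _ => hit T y)
        (by simpa using hx)) (h0 x)
  have hS : HasSum (fun t => notHitProb P ν m t) (∑ x, ν x * h x) := by
    rw [hsumm.hasSum_iff_tendsto_nat]
    have h1 := hrest.const_sub (∑ x, ν x * h x)
    rw [sub_zero] at h1
    refine h1.congr fun T => ?_
    rw [← sum_notHitProb_add hm hh T ν, add_sub_cancel_right]
  rw [expectedHit, ← ENNReal.ofReal_tsum_of_nonneg hnn hsumm, hS.tsum_eq]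

theorem hittingTime_randomWalk_eq [Nontrivial V] {G : SimpleGraph V} [DecidableRel G.Adj] {d : ℕ}
    {m : V} {h : V → ℝ} (hd0 : 0 < d) (hd : G.IsRegularOfDegree d)
    (hh : IsHittingPotential G d m h) :
    hittingTime (randomWalk G) m
      = ENNReal.ofReal ((∑ x, h x) / ((Fintype.card V : ℝ) - 1)) := by
  have hN : (0 : ℝ) ≤ (Fintype.card V : ℝ) - 1 := by
    have := Fintype.one_lt_card (α := V)
    rw [sub_nonneg]; exact_mod_cast this.le
  rw [hittingTime, expectedHit_eq (h := h) _ hh.marked (hh.nonneg hd0)]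
  · congr 1
    rw [Finset.sum_div]
    refine Finset.sum_congr rfl fun x _ => ?_
    by_cases hx : x = m
    · rw [hx, hh.marked, mul_zero, zero_div]
    · rw [uniformUnmarked, if_neg hx]; ring
  · intro x hx
    have h1 := hh.unmarked x hx
    have hd' : (d : ℝ) ≠ 0 := by exact_mod_cast hd0.ne'
    rw [Finset.sum_sub_distrib, Finset.sum_const, G.card_neighborFinset_eq_degree, hd x,
      nsmul_eq_mul] at h1
    have h2 : ∑ y, randomWalk G x y * h y = (∑ y ∈ G.neighborFinset x, h y) / d := by
      rw [SimpleGraph.neighborFinset_eq_filter, Finset.sum_filter, Finset.sum_div]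
      refine Finset.sum_congr rfl fun y _ => ?_
      simp only [randomWalk, Matrix.of_apply, hd x]
      split_ifs <;> ring
    rw [h2]
    field_simp
    linarith
  · intro x
    rw [uniformUnmarked]
    split_ifs
    · exact le_rfl
    · exact div_nonneg zero_le_one hN
  · intro x y
    simp only [randomWalk, Matrix.of_apply]
    split_ifs <;> positivity

end Hitting

/-! ### States with real amplitudes and permutation operators -/

section Vectors

variable {ι : Type*} [Fintype ι]

/-- The state with the real amplitudes `f`. -/
def realVec (f : ι → ℝ) : Hilb ι :=
  WithLp.toLp 2 fun i => (f i : ℂ)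

@[simp]
theorem realVec_apply (f : ι → ℝ) (i : ι) : realVec f i = (f i : ℂ) := rfl

theorem norm_sq_realVec (f : ι → ℝ) : ‖realVec f‖ ^ 2 = ∑ i, f i ^ 2 := by
  rw [EuclideanSpace.norm_sq_eq]
  refine Finset.sum_congr rfl fun i _ => ?_
  rw [realVec_apply, Complex.norm_real, Real.norm_eq_abs, sq_abs]

theorem inner_realVec (b : Hilb ι) (f : ι → ℝ) :
    inner ℂ b (realVec f) = ∑ i, (starRingEnd ℂ) (b i) * (f i : ℂ) := by
  rw [PiLp.inner_apply]
  refine Finset.sum_congr rfl fun i _ => ?_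
  rw [realVec_apply, RCLike.inner_apply, mul_comm]

theorem ket_apply [DecidableEq ι] (i j : ι) : (ket i : Hilb ι) j = if j = i then 1 else 0 := by
  simp [ket]

theorem tens_apply {κ : Type*} [Fintype κ] (ψ : Hilb ι) (φ : Hilb κ) (x : ι) (y : κ) :
    tens ψ φ (x, y) = ψ x * φ y := rfl

variable [DecidableEq ι] {σ : ι → ι}

theorem toEuclideanLin_involution_apply (hσ : Function.Involutive σ) (f : Hilb ι) (i : ι) :
    Matrix.toEuclideanLin (Matrix.of fun p q => if p = σ q then (1 : ℂ) else 0) f i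
      = f (σ i) := by
  rw [Matrix.ofLp_toLpLin, Matrix.toLin'_apply]
  simp only [Matrix.mulVec, dotProduct, Matrix.of_apply]
  rw [Finset.sum_eq_single (σ i)]
  · simp [hσ i]
  · intro j _ hj
    rw [if_neg fun h => hj (by rw [h, hσ j]), zero_mul]
  · simp

theorem norm_toEuclideanLin_involution (hσ : Function.Involutive σ) (f : Hilb ι) :
    ‖Matrix.toEuclideanLin (Matrix.of fun p q => if p = σ q then (1 : ℂ) else 0) f‖ = ‖f‖ := by
  rw [EuclideanSpace.norm_eq, EuclideanSpace.norm_eq]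
  simp only [toEuclideanLin_involution_apply hσ]
  exact congrArg _ (Equiv.sum_comp (hσ.toPerm σ) fun i => ‖f i‖ ^ 2)

end Vectors

/-! ### The reflection about the row space -/

section RowSpace

variable {V : Type*} [Fintype V] [DecidableEq V]

theorem rowState_apply (P : Matrix V V ℝ) (x y : V) :
    rowState P x y = (Real.sqrt (P x y) : ℂ) := by
  simp [rowState, ket_apply]

theorem inner_tens_rowState (P : Matrix V V ℝ) (x : V) (b : Hilb (V × V)) :
    inner ℂ (tens (ket x) (rowState P x)) b = ∑ y, (Real.sqrt (P x y) : ℂ) * b (x, y) := by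
  rw [PiLp.inner_apply, Fintype.sum_prod_type, Finset.sum_eq_single x]
  · refine Finset.sum_congr rfl fun y _ => ?_
    rw [tens_apply, ket_apply, rowState_apply, if_pos rfl, one_mul, RCLike.inner_apply,
      Complex.conj_ofReal, mul_comm]
  · intro z _ hz
    refine Finset.sum_eq_zero fun y _ => ?_
    rw [tens_apply, ket_apply, if_neg hz, zero_mul, inner_zero_left]
  · simp

theorem sum_smul_tens_rowState (P : Matrix V V ℝ) (c : V → ℝ) :
    ∑ x, (c x : ℂ) • tens (ket x) (rowState P x)
      = realVec fun q : V × V => c q.1 * Real.sqrt (P q.1 q.2) := by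
  ext ⟨x, y⟩
  simp [tens_apply, ket_apply, rowState_apply]

theorem reflection_rowSpace_eq_self (P : Matrix V V ℝ) (c : V → ℝ) :
    (rowSpace P).reflection.toLinearMap
        (realVec fun q : V × V => c q.1 * Real.sqrt (P q.1 q.2))
      = realVec fun q : V × V => c q.1 * Real.sqrt (P q.1 q.2) := by
  refine Submodule.reflection_mem_subspace_eq_self ?_
  rw [← sum_smul_tens_rowState]
  exact Submodule.sum_mem _ fun x _ =>
    Submodule.smul_mem _ _ (Submodule.subset_span ⟨x, rfl⟩)

theorem reflection_rowSpace_eq_neg_iff (P : Matrix V V ℝ) (b : Hilb (V × V)) :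
    (rowSpace P).reflection.toLinearMap b = -b
      ↔ ∀ x, ∑ y, (Real.sqrt (P x y) : ℂ) * b (x, y) = 0 := by
  have h1 : (rowSpace P).reflection.toLinearMap b = -b ↔ b ∈ (rowSpace P)ᗮ := by
    rw [← Submodule.reflection_eq_self_iff, Submodule.reflection_orthogonal_apply]
    exact ⟨fun h => by rw [neg_eq_iff_eq_neg]; exact h, fun h => neg_eq_iff_eq_neg.1 h⟩
  rw [h1, Submodule.mem_orthogonal]
  constructor
  · intro h x
    rw [← inner_tens_rowState]
    exact h _ (Submodule.subset_span ⟨x, rfl⟩)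
  · intro h u hu
    induction hu using Submodule.span_induction with
    | mem u hu =>
      obtain ⟨x, rfl⟩ := hu
      rw [inner_tens_rowState, h x]
    | zero => exact inner_zero_left _
    | add u v _ _ hu hv => rw [inner_add_left, hu, hv, add_zero]
    | smul c u _ hu => rw [inner_smul_left, hu, mul_zero]

theorem swapOp_apply (b : Hilb (V × V)) (x y : V) : swapOp b (x, y) = b (y, x) :=
  toEuclideanLin_involution_apply (σ := Prod.swap) Prod.swap_swap b (x, y)

theorem norm_swapOp (b : Hilb (V × V)) : ‖swapOp b‖ = ‖b‖ :=
  norm_toEuclideanLin_involution (σ := Prod.swap) Prod.swap_swap b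

end RowSpace

/-! ### The quantum interpolated walk -/

section Interpolated

variable {V : Type*} [Fintype V] [DecidableEq V] {G : SimpleGraph V} [DecidableRel G.Adj]
  {d : ℕ} {m : V} {h : V → ℝ}

/-- The value of the parameter is `s = 1 - 1 / N`, so the amplitudes of `P(s)` on the arcs that
leave `m` are smaller than the others by the factor `√N`. -/
theorem sqrt_interpolated (hd : G.IsRegularOfDegree d) (x y : V) :
    Real.sqrt (interpolated (randomWalk G) m (1 - 1 / (Fintype.card V : ℝ)) x y)
      = if G.Adj x y then (if x = m then 1 / Real.sqrt (Fintype.card V) else 1) / Real.sqrt d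
        else if x = m ∧ y = m then Real.sqrt (1 - 1 / (Fintype.card V : ℝ)) else 0 := by
  simp only [interpolated, absorbing, randomWalk, Matrix.add_apply, Matrix.smul_apply,
    Matrix.of_apply, hd x, smul_eq_mul, sub_sub_cancel]
  by_cases hxy : G.Adj x y
  · by_cases hx : x = m
    · have hy : y ≠ m := fun hy => hxy.ne (hx.trans hy.symm)
      simp only [if_pos hxy, if_pos hx, if_neg hy]
      rw [mul_zero, add_zero, Real.sqrt_mul (by positivity), Real.sqrt_div zero_le_one,
        Real.sqrt_div zero_le_one, Real.sqrt_one, mul_one_div]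
    · simp only [if_pos hxy, if_neg hx]
      rw [← add_mul, add_sub_cancel, one_mul, Real.sqrt_div zero_le_one, Real.sqrt_one]
  · by_cases hx : x = m
    · by_cases hy : y = m
      · subst hx; subst hy; simp
      · rw [if_neg hxy, if_pos hx, if_neg hy, if_neg hxy, if_neg fun h => hy h.2]
        simp
    · rw [if_neg hxy, if_neg hx, if_neg hxy, if_neg fun h => hx h.1]
      simp

theorem sum_sqrt_interpolated_mul (hd : G.IsRegularOfDegree d) (x : V) (φ : V → ℂ) :
    ∑ y, (Real.sqrt (interpolated (randomWalk G) m (1 - 1 / (Fintype.card V : ℝ)) x y) : ℂ) * φ y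
      = (((if x = m then 1 / Real.sqrt (Fintype.card V) else 1) / Real.sqrt d : ℝ) : ℂ)
          * ∑ y ∈ G.neighborFinset x, φ y
        + if x = m then (Real.sqrt (1 - 1 / (Fintype.card V : ℝ)) : ℂ) * φ m else 0 := by
  have h1 : ∀ y,
      (Real.sqrt (interpolated (randomWalk G) m (1 - 1 / (Fintype.card V : ℝ)) x y) : ℂ) * φ y
      = (if G.Adj x y then
          (((if x = m then 1 / Real.sqrt (Fintype.card V) else 1) / Real.sqrt d : ℝ) : ℂ) * φ y
          else 0)
        + if y = m then
            (if x = m then (Real.sqrt (1 - 1 / (Fintype.card V : ℝ)) : ℂ) * φ m else 0) else 0 := by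
    intro y
    rw [sqrt_interpolated hd]
    by_cases hxy : G.Adj x y
    · rw [if_pos hxy, if_pos hxy]
      by_cases hy : y = m
      · have hx : x ≠ m := fun hx => hxy.ne (hx.trans hy.symm)
        rw [if_pos hy, if_neg hx, if_neg hx, add_zero]
      · rw [if_neg hy, add_zero]
    · rw [if_neg hxy, if_neg hxy, zero_add]
      by_cases hx : x = m <;> by_cases hy : y = m <;> simp [hx, hy]
  rw [Finset.sum_congr rfl fun y _ => h1 y, Finset.sum_add_distrib, Finset.sum_ite_eq',
    if_pos (Finset.mem_univ m), Finset.mul_sum, SimpleGraph.neighborFinset_eq_filter,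
    Finset.sum_filter]

theorem sum_interpolated_row (hd0 : 0 < d) (hd : G.IsRegularOfDegree d) (x : V) :
    ∑ y, Real.sqrt (interpolated (randomWalk G) m (1 - 1 / (Fintype.card V : ℝ)) x y) ^ 2 = 1 := by
  have hN : (1 : ℝ) ≤ Fintype.card V := by exact_mod_cast Fintype.card_pos_iff.2 ⟨x⟩
  have hd' : (0 : ℝ) < d := by exact_mod_cast hd0
  have h1 : ∀ y,
      Real.sqrt (interpolated (randomWalk G) m (1 - 1 / (Fintype.card V : ℝ)) x y) ^ 2
      = (if G.Adj x y then (if x = m then 1 / (Fintype.card V : ℝ) else 1) / d else 0)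
        + if y = m then (if x = m then 1 - 1 / (Fintype.card V : ℝ) else 0) else 0 := by
    intro y
    have hs : 0 ≤ 1 - 1 / (Fintype.card V : ℝ) :=
      sub_nonneg.2 ((div_le_one (by linarith)).2 hN)
    rw [sqrt_interpolated hd]
    by_cases hxy : G.Adj x y
    · rw [if_pos hxy, if_pos hxy, div_pow, Real.sq_sqrt hd'.le]
      by_cases hx : x = m
      · rw [if_pos hx, if_pos hx, if_neg (show ¬y = m from fun hy => hxy.ne (hx.trans hy.symm)),
          div_pow, Real.sq_sqrt (by linarith)]
        ring
      · simp [hx]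
    · rw [if_neg hxy, if_neg hxy, zero_add]
      by_cases hx : x = m <;> by_cases hy : y = m <;> simp [hx, hy]
      rw [Real.sq_sqrt (by simpa using hs)]
  rw [Finset.sum_congr rfl fun y _ => h1 y, Finset.sum_add_distrib, Finset.sum_ite_eq',
    if_pos (Finset.mem_univ m), ← Finset.sum_filter, ← SimpleGraph.neighborFinset_eq_filter,
    Finset.sum_const, G.card_neighborFinset_eq_degree, hd x, nsmul_eq_mul]
  split_ifs <;> field_simp <;> ring

/-- The unit-source current in the network of the interpolated walk is a multiple of the gradient
of the hitting times, on the arcs of `G`; the loop at `m` carries none. -/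
theorem cotQHT_interpolatedWalk_sq [Nontrivial V] (hd0 : 0 < d) (hd : G.IsRegularOfDegree d)
    (hh : IsHittingPotential G d m h) {s : ℝ} (hs : s = 1 - 1 / (Fintype.card V : ℝ)) :
    cotQHT (interpolatedWalk (randomWalk G) m s) (interpolatedInit (randomWalk G) m s) ^ 2
      = 2 * (Fintype.card V : ℝ) ^ 2
          / ((2 * (Fintype.card V : ℝ) - 1) ^ 2 * ((Fintype.card V : ℝ) - 1)) * ∑ x, h x
        - (Fintype.card V : ℝ) / (2 * (Fintype.card V : ℝ) - 1) := by
  subst hs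
  set N : ℝ := (Fintype.card V : ℝ) with hN
  have hN1 : 1 < N := by
    rw [hN]; exact_mod_cast Fintype.one_lt_card (α := V)
  have hd' : (0 : ℝ) < d := by exact_mod_cast hd0
  set P := interpolated (randomWalk G) m (1 - 1 / N) with hP
  set q := Real.sqrt N with hq
  set p := Real.sqrt (N - 1) with hp
  set r := Real.sqrt d with hr
  have hq2 : q ^ 2 = N := Real.sq_sqrt (by linarith)
  have hp2 : p ^ 2 = N - 1 := Real.sq_sqrt (by linarith)
  have hr2 : r ^ 2 = d := Real.sq_sqrt hd'.le
  have hq0 : 0 < q := Real.sqrt_pos.2 (by linarith)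
  have hp0 : 0 < p := Real.sqrt_pos.2 (by linarith)
  have hr0 : 0 < r := Real.sqrt_pos.2 hd'
  have hD : 0 < 2 * N - 1 := by linarith
  have hN0 : N - 1 ≠ 0 := by linarith
  -- `w₀` is the projection of the initial state to the stationary vector, whose amplitudes are
  -- the square roots of the stationary distribution of `P(s)`.
  let c₀ : V → ℝ := fun x => p / (2 * N - 1) * if x = m then q else 1
  let c₁ : V → ℝ := fun x => if x = m then -(p * q / (2 * N - 1)) else N / ((2 * N - 1) * p)
  -- `α` matches the source `d` of the potential to the amplitude of `w₁` at unmarked vertices.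
  let α : ℝ := N / ((2 * N - 1) * p * r)
  let F : V × V → ℝ := fun z => if G.Adj z.1 z.2 then α * (h z.1 - h z.2) else 0
  have hinit : interpolatedInit (randomWalk G) m (1 - 1 / N)
      = realVec (fun z : V × V => c₀ z.1 * Real.sqrt (P z.1 z.2))
        + realVec (fun z : V × V => c₁ z.1 * Real.sqrt (P z.1 z.2)) := by
    have hc : ∀ x, (if x ≠ m then 1 / p else 0) = c₀ x + c₁ x := by
      intro x
      by_cases hx : x = m
      · simp only [c₀, c₁, hx, if_true, ne_eq, not_true_eq_false, if_false]
        ring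
      · simp only [c₀, c₁, hx, if_false, ne_eq, not_false_eq_true, if_true]
        field_simp
        rw [hp2]; ring
    have h1 : interpolatedInit (randomWalk G) m (1 - 1 / N)
        = ∑ x, (((if x ≠ m then 1 / p else 0 : ℝ)) : ℂ) • tens (ket x) (rowState P x) := by
      rw [interpolatedInit, Finset.smul_sum, Finset.sum_filter]
      refine Finset.sum_congr rfl fun x _ => ?_
      split_ifs
      · rfl
      · simp
    rw [h1, sum_smul_tens_rowState]
    ext z
    simp only [PiLp.add_apply, realVec_apply]
    rw [hc]
    push_cast
    ring
  have hsqrt : ∀ x y, Real.sqrt (P x y) = if G.Adj x y then (if x = m then 1 / q else 1) / r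
      else if x = m ∧ y = m then Real.sqrt (1 - 1 / N) else 0 := sqrt_interpolated hd
  have hrow : ∀ x, ∑ y, Real.sqrt (P x y) ^ 2 = 1 := sum_interpolated_row hd0 hd
  have hsum : ∀ x (φ : V → ℂ), ∑ y, (Real.sqrt (P x y) : ℂ) * φ y
      = (((if x = m then 1 / q else 1) / r : ℝ) : ℂ) * ∑ y ∈ G.neighborFinset x, φ y
        + if x = m then (Real.sqrt (1 - 1 / N) : ℂ) * φ m else 0 :=
    fun x φ => sum_sqrt_interpolated_mul hd x φ
  have hFm : F (m, m) = 0 := if_neg (G.loopless.irrefl m)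
  have hFN : ∀ x, ∑ y ∈ G.neighborFinset x, F (x, y)
      = α * ∑ y ∈ G.neighborFinset x, (h x - h y) := by
    intro x
    rw [Finset.mul_sum]
    exact Finset.sum_congr rfl fun y hy => if_pos (by simpa using hy)
  rw [hinit, interpolatedWalk, szegedy, ← hP, cotQHT_sq_eq_energy (g := realVec F)
    norm_swapOp (fun x => LinearIsometryEquiv.norm_map _ x)
    (fun b => by ext ⟨x, y⟩; rw [swapOp_apply, swapOp_apply])
    (Submodule.reflection_reflection _) ?_ (reflection_rowSpace_eq_self P c₀)
    (reflection_rowSpace_eq_self P c₁) ?_ ?_ ?_]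
  · have hF : ‖realVec F‖ ^ 2 = α ^ 2 * (2 * (d * ∑ x, h x)) := by
      rw [norm_sq_realVec, Fintype.sum_prod_type, ← hh.energy, Finset.mul_sum]
      refine Finset.sum_congr rfl fun x _ => ?_
      rw [Finset.mul_sum, SimpleGraph.neighborFinset_eq_filter, Finset.sum_filter]
      refine Finset.sum_congr rfl fun y _ => ?_
      simp only [F]
      split_ifs <;> ring
    have hw : ‖realVec fun z : V × V => c₁ z.1 * Real.sqrt (P z.1 z.2)‖ ^ 2
        = N / (2 * N - 1) := by
      rw [norm_sq_realVec, Fintype.sum_prod_type]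
      simp only [mul_pow, ← Finset.mul_sum, hrow, mul_one]
      rw [← Finset.add_sum_erase _ _ (Finset.mem_univ m),
        Finset.sum_congr rfl fun x hx => by
          rw [show c₁ x = N / ((2 * N - 1) * p) from if_neg (Finset.ne_of_mem_erase hx)],
        Finset.sum_const, Finset.card_erase_of_mem (Finset.mem_univ m), Finset.card_univ,
        nsmul_eq_mul, Nat.cast_sub Fintype.card_pos, ← hN,
        show c₁ m = -(p * q / (2 * N - 1)) from if_pos rfl]
      push_cast
      simp only [neg_sq, div_pow, mul_pow, hp2, hq2]
      have hD0 : N * 2 - 1 ≠ 0 := by linarith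
      field_simp
      ring
    rw [hF, hw]
    congr 1
    simp only [α, div_pow, mul_pow, hp2, hr2]
    field_simp
  · ext ⟨x, y⟩
    rw [swapOp_apply, realVec_apply, realVec_apply]
    congr 1
    simp only [c₀, hsqrt]
    by_cases hxy : G.Adj x y
    · rw [if_pos hxy, if_pos hxy.symm]
      by_cases hx : x = m
      · have hy : y ≠ m := fun hy => hxy.ne (hx.trans hy.symm)
        simp only [hx, hy, if_true, if_false]
        field_simp
      · by_cases hy : y = m
        · simp only [hx, hy, if_true, if_false]
          field_simp
        · simp only [hx, hy, if_false]
    · have hyx : ¬G.Adj y x := fun h' => hxy h'.symm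
      rw [if_neg hxy, if_neg hyx]
      by_cases hx : x = m <;> by_cases hy : y = m <;> simp only [hx, hy, and_true, and_false,
        if_true, if_false, mul_zero]
  · ext ⟨x, y⟩
    rw [swapOp_apply, PiLp.neg_apply, realVec_apply, realVec_apply, ← Complex.ofReal_neg]
    congr 1
    by_cases hxy : G.Adj x y
    · simp only [F, if_pos hxy, if_pos hxy.symm]; ring
    · have hyx : ¬G.Adj y x := fun h' => hxy h'.symm
      simp only [F, if_neg hxy, if_neg hyx, neg_zero]
  · rw [reflection_rowSpace_eq_neg_iff]
    intro x
    simp only [PiLp.sub_apply, realVec_apply, mul_sub, Finset.sum_sub_distrib]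
    rw [hsum x fun y => (F (x, y) : ℂ)]
    have h2 : ∑ y, (Real.sqrt (P x y) : ℂ) * ((c₁ x * Real.sqrt (P x y) : ℝ) : ℂ) = (c₁ x : ℂ) := by
      have h3 : c₁ x * ∑ y, Real.sqrt (P x y) ^ 2 = c₁ x := by rw [hrow x, mul_one]
      conv_rhs => rw [← h3, Finset.mul_sum]
      push_cast
      exact Finset.sum_congr rfl fun y _ => by ring
    rw [h2, ← Complex.ofReal_sum, hFN]
    by_cases hx : x = m
    · subst hx
      rw [if_pos rfl, if_pos rfl, hFm, Complex.ofReal_zero, mul_zero, add_zero,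
        ← Complex.ofReal_mul, ← Complex.ofReal_sub, hh.sum_marked, ← hN,
        show c₁ x = -(p * q / (2 * N - 1)) from if_pos rfl]
      norm_cast
      simp only [α]
      rw [← hr2, ← hp2, ← hq2]
      field_simp
      ring
    · rw [if_neg hx, if_neg hx, add_zero, ← Complex.ofReal_mul, ← Complex.ofReal_sub,
        hh.unmarked x hx, show c₁ x = N / ((2 * N - 1) * p) from if_neg hx]
      norm_cast
      simp only [α]
      rw [← hr2]
      field_simp
      ring
  · intro b hbS hbR
    rw [reflection_rowSpace_eq_neg_iff] at hbR
    have hanti : ∀ x y, b (y, x) = -b (x, y) := by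
      intro x y
      rw [← swapOp_apply, hbS, PiLp.neg_apply]
    have hbm : b (m, m) = 0 := self_eq_neg.1 (hanti m m)
    have hdiv : ∀ x, ∑ y ∈ G.neighborFinset x, b (x, y) = 0 := by
      intro x
      have h1 := hbR x
      have h2 : (if x = m then (Real.sqrt (1 - 1 / N) : ℂ) * b (x, m) else 0) = 0 := by
        split_ifs with hx
        · rw [hx, hbm, mul_zero]
        · rfl
      rw [hsum, h2, add_zero] at h1
      refine (mul_eq_zero.1 h1).resolve_left (Complex.ofReal_ne_zero.2 ?_)
      split_ifs <;> positivity
    have h0 := circulation_mul_gradient_eq_zero (G := G)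
      (k := fun x y => (starRingEnd ℂ) (b (x, y)))
      (fun x y _ => by rw [hanti x y, map_neg])
      (fun x => by rw [← map_sum, hdiv, map_zero]) fun x => (h x : ℂ)
    rw [inner_realVec, Fintype.sum_prod_type, ← mul_zero (α : ℂ), ← h0, Finset.mul_sum]
    refine Finset.sum_congr rfl fun x _ => ?_
    rw [Finset.mul_sum, SimpleGraph.neighborFinset_eq_filter, Finset.sum_filter]
    refine Finset.sum_congr rfl fun y _ => ?_
    simp only [F]
    split_ifs
    · push_cast; ring
    · simp

end Interpolated

/-! ### The operators of the lackadaisical walk -/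

section Operators

variable {V : Type*} [Fintype V] [DecidableEq V] {G : SimpleGraph V} [DecidableRel G.Adj]
  {d : ℕ}

omit [Fintype V] [DecidableEq V] [DecidableRel G.Adj] in
theorem flipArc_eq (nbr : (x : V) → Fin d ≃ G.neighborSet x) {x y : V} {i j : Fin d}
    (hi : (nbr x i : V) = y) (hj : (nbr y j : V) = x) :
    flipArc nbr (x, some i) = (y, some j) := by
  subst hi
  rw [flipArc]
  refine Prod.ext rfl (congrArg some ?_)
  rw [Equiv.symm_apply_eq]
  exact Subtype.ext hj.symm

omit [Fintype V] [DecidableEq V] [DecidableRel G.Adj] in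
theorem exists_flipArc_eq (nbr : (x : V) → Fin d ≃ G.neighborSet x) (x : V) (i : Fin d) :
    ∃ j, (nbr (nbr x i : V) j : V) = x ∧ flipArc nbr (x, some i) = ((nbr x i : V), some j) := by
  have hj : (nbr (nbr x i : V) ((nbr (nbr x i : V)).symm ⟨x, (nbr x i).2.symm⟩) : V) = x := by
    rw [Equiv.apply_symm_apply]
  exact ⟨_, hj, flipArc_eq nbr rfl hj⟩

omit [Fintype V] [DecidableEq V] [DecidableRel G.Adj] in
theorem flipArc_involutive (nbr : (x : V) → Fin d ≃ G.neighborSet x) :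
    Function.Involutive (flipArc nbr) := by
  rintro ⟨x, _ | i⟩
  · rfl
  · obtain ⟨j, hj, h⟩ := exists_flipArc_eq nbr x i
    rw [h]
    exact flipArc_eq nbr hj rfl

omit [DecidableEq V] in
theorem sum_nbr {A : Type*} [AddCommMonoid A] (nbr : (x : V) → Fin d ≃ G.neighborSet x) (x : V)
    (φ : V → A) : ∑ i, φ (nbr x i) = ∑ y ∈ G.neighborFinset x, φ y := by
  refine Finset.sum_bij (fun i _ => (nbr x i : V)) (fun i _ => ?_) (fun i _ j _ hij => ?_)
    (fun y hy => ?_) fun i _ => rfl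
  · rw [SimpleGraph.mem_neighborFinset]; exact (nbr x i).2
  · exact (nbr x).injective (Subtype.ext hij)
  · refine ⟨(nbr x).symm ⟨y, by simpa using hy⟩, Finset.mem_univ _, ?_⟩
    rw [Equiv.apply_symm_apply]

/-- The amplitudes of the coin state. -/
def coinAmp (d : ℕ) (l : ℝ) : Coin d → ℝ
  | some _ => 1 / Real.sqrt (d + l)
  | none => Real.sqrt l / Real.sqrt (d + l)

theorem coinState_eq (d : ℕ) (l : ℝ) : coinState d l = realVec (coinAmp d l) := by
  ext e
  cases e <;> simp [coinState, coinAmp, ket_apply, div_eq_mul_inv, mul_comm]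

theorem sum_coinAmp_sq {l : ℝ} (hd : 0 < d) (hl : 0 ≤ l) : ∑ e, coinAmp d l e ^ 2 = 1 := by
  have hd' : (0 : ℝ) < d := by exact_mod_cast hd
  have h : (d : ℝ) + l ≠ 0 := by linarith
  rw [Fintype.sum_option]
  simp only [coinAmp, div_pow, Real.sq_sqrt hl, Real.sq_sqrt (add_nonneg hd'.le hl),
    Finset.sum_const, Finset.card_univ, Fintype.card_fin, nsmul_eq_mul]
  field_simp
  ring

/-- The coin and the query together. This is a reflection: it is `2 |c⟩⟨c| - I` at an unmarked
vertex, and its negative at `m`. -/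
def coinQuery (d : ℕ) (l : ℝ) (m : V) : Module.End ℂ (Hilb (V × Coin d)) :=
  Matrix.toEuclideanLin (((1 : Matrix V V ℂ) ⊗ₖ coinOp d l) * queryOp d m)

omit [DecidableRel G.Adj] in
theorem lackadaisicalWalk_eq (nbr : (x : V) → Fin d ≃ G.neighborSet x) (l : ℝ) (m : V) :
    lackadaisicalWalk nbr l m
      = Matrix.toEuclideanLin (shiftOp nbr) * coinQuery d l m := by
  ext f p
  rw [lackadaisicalWalk, coinQuery, Module.End.mul_apply, Matrix.mul_assoc]
  simp only [Matrix.ofLp_toLpLin, Matrix.toLin'_apply, Matrix.mulVec_mulVec]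

theorem coin_mul_query (d : ℕ) (l : ℝ) (m : V) :
    ((1 : Matrix V V ℂ) ⊗ₖ coinOp d l) * queryOp d m
      = ((1 : Matrix V V ℂ) - (2 : ℂ) • ketBra (ket m)) ⊗ₖ coinOp d l := by
  rw [queryOp, ← Matrix.mul_kronecker_mul, one_mul, mul_one]

theorem isHermitian_ketBra {ι : Type*} [Fintype ι] (ψ : Hilb ι) : (ketBra ψ).IsHermitian := by
  ext i j
  simp [ketBra, Matrix.vecMulVec_apply, mul_comm]

theorem coinQuery_isSymmetric (d : ℕ) (l : ℝ) (m : V) : (coinQuery d l m).IsSymmetric := by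
  have h2 : IsSelfAdjoint (2 : ℂ) := by
    rw [isSelfAdjoint_iff]; simp
  rw [coinQuery, Matrix.isSymmetric_toEuclideanLin_iff, coin_mul_query, Matrix.IsHermitian,
    Matrix.conjTranspose_kronecker]
  congr 1
  · exact Matrix.isHermitian_one.sub ((isHermitian_ketBra _).smul h2)
  · exact ((isHermitian_ketBra _).smul h2).sub Matrix.isHermitian_one

theorem coinQuery_apply (d : ℕ) (l : ℝ) (m : V) (f : Hilb (V × Coin d)) (x : V) (e : Coin d) :
    coinQuery d l m f (x, e) = (if x = m then -1 else 1)
      * (2 * coinAmp d l e * (∑ e', (coinAmp d l e' : ℂ) * f (x, e')) - f (x, e)) := by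
  rw [coinQuery, coin_mul_query, Matrix.ofLp_toLpLin, Matrix.toLin'_apply, Matrix.mulVec,
    dotProduct, Fintype.sum_prod_type, Finset.sum_eq_single x]
  · have h1 : ∀ e' : Coin d, (((1 : Matrix V V ℂ) - (2 : ℂ) • ketBra (ket m)) ⊗ₖ coinOp d l)
        (x, e) (x, e') = (if x = m then -1 else 1)
          * (2 * coinAmp d l e * coinAmp d l e' - if e = e' then 1 else 0) := by
      intro e'
      rw [Matrix.kroneckerMap_apply, coinOp, coinState_eq]
      simp only [Matrix.sub_apply, Matrix.smul_apply, ketBra, Matrix.vecMulVec_apply,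
        Matrix.one_apply, Pi.star_apply, realVec_apply, ket_apply, smul_eq_mul]
      congr 1
      · split_ifs <;> simp <;> norm_num
      · simp [mul_assoc]
    generalize (if x = m then (-1 : ℂ) else 1) = ε at h1 ⊢
    simp only [h1, mul_assoc, sub_mul, ite_mul, one_mul, zero_mul, ← Finset.mul_sum,
      Finset.sum_sub_distrib, Finset.sum_ite_eq, Finset.mem_univ, if_true]
  · intro y _ hy
    refine Finset.sum_eq_zero fun e' _ => ?_
    rw [Matrix.kroneckerMap_apply]
    have : ((1 : Matrix V V ℂ) - (2 : ℂ) • ketBra (ket m)) x y = 0 := by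
      simp only [Matrix.sub_apply, Matrix.smul_apply, ketBra, Matrix.vecMulVec_apply,
        Matrix.one_apply, Pi.star_apply, ket_apply, smul_eq_mul, if_neg (Ne.symm hy)]
      by_cases hx : x = m
      · have hym : y ≠ m := fun h => hy (h.trans hx.symm)
        simp [hym]
      · simp [hx]
    rw [this, zero_mul, zero_mul]
  · simp

variable {l : ℝ} {m : V}

theorem sum_coinAmp_mul_self (hd : 0 < d) (hl : 0 ≤ l) :
    ∑ e, (coinAmp d l e : ℂ) * coinAmp d l e = 1 := by
  rw [← Complex.ofReal_one, ← sum_coinAmp_sq hd hl]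
  push_cast
  exact Finset.sum_congr rfl fun e _ => (sq _).symm

theorem coinQuery_coinQuery (hd : 0 < d) (hl : 0 ≤ l) (f : Hilb (V × Coin d)) :
    coinQuery d l m (coinQuery d l m f) = f := by
  ext ⟨x, e⟩
  have h1 : ∑ e', (coinAmp d l e' : ℂ) * coinQuery d l m f (x, e')
      = (if x = m then -1 else 1) * ∑ e', (coinAmp d l e' : ℂ) * f (x, e') := by
    set s := ∑ e', (coinAmp d l e' : ℂ) * f (x, e') with hs
    have h2 : ∀ e', (coinAmp d l e' : ℂ) * coinQuery d l m f (x, e')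
        = (if x = m then -1 else 1) * (2 * s * ((coinAmp d l e' : ℂ) * coinAmp d l e')
          - (coinAmp d l e' : ℂ) * f (x, e')) := by
      intro e'
      rw [coinQuery_apply, ← hs]
      ring
    rw [Finset.sum_congr rfl fun e' _ => h2 e', ← Finset.mul_sum, Finset.sum_sub_distrib,
      ← Finset.mul_sum, sum_coinAmp_mul_self hd hl, ← hs]
    ring
  rw [coinQuery_apply, h1, coinQuery_apply]
  split_ifs <;> ring

theorem norm_coinQuery (hd : 0 < d) (hl : 0 ≤ l) (f : Hilb (V × Coin d)) :
    ‖coinQuery d l m f‖ = ‖f‖ := by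
  have h : inner ℂ (coinQuery d l m f) (coinQuery d l m f) = inner ℂ f f := by
    rw [coinQuery_isSymmetric d l m, coinQuery_coinQuery hd hl]
  rw [@norm_eq_sqrt_re_inner ℂ, h, ← @norm_eq_sqrt_re_inner ℂ]

theorem coinQuery_eq_self (hd : 0 < d) (hl : 0 ≤ l) {f : V × Coin d → ℝ} {t : V → ℝ}
    (hf : ∀ x, x ≠ m → ∀ e, f (x, e) = t x * coinAmp d l e)
    (hm : ∑ e, coinAmp d l e * f (m, e) = 0) :
    coinQuery d l m (realVec f) = realVec f := by
  ext ⟨x, e⟩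
  rw [coinQuery_apply]
  simp only [realVec_apply, ← Complex.ofReal_mul, ← Complex.ofReal_sum]
  by_cases hx : x = m
  · subst hx
    rw [hm, if_pos rfl]
    push_cast
    ring
  · have h1 : ∑ e', coinAmp d l e' * f (x, e') = t x := by
      rw [← mul_one (t x), ← sum_coinAmp_sq hd hl, Finset.mul_sum]
      refine Finset.sum_congr rfl fun e' _ => ?_
      rw [hf x hx]; ring
    rw [h1, if_neg hx, hf x hx]
    push_cast
    ring

theorem coinQuery_eq_neg (hd : 0 < d) (hl : 0 ≤ l) {f : V × Coin d → ℝ} {t : ℝ}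
    (hf : ∀ x, x ≠ m → ∑ e, coinAmp d l e * f (x, e) = 0)
    (hm : ∀ e, f (m, e) = t * coinAmp d l e) :
    coinQuery d l m (realVec f) = -realVec f := by
  ext ⟨x, e⟩
  rw [coinQuery_apply, PiLp.neg_apply]
  simp only [realVec_apply, ← Complex.ofReal_mul, ← Complex.ofReal_sum]
  by_cases hx : x = m
  · subst hx
    have h1 : ∑ e', coinAmp d l e' * f (x, e') = t := by
      rw [← mul_one t, ← sum_coinAmp_sq hd hl, Finset.mul_sum]
      refine Finset.sum_congr rfl fun e' _ => ?_
      rw [hm]; ring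
    rw [h1, if_pos rfl, hm]
    push_cast
    ring
  · rw [hf x hx, if_neg hx]
    push_cast
    ring

/-- A vector of the `-1`-eigenspace without loop amplitudes has zero divergence at every vertex,
even at `m`: there it is a multiple of the coin state, whose loop amplitude is not zero. -/
theorem divergence_eq_zero_of_coinQuery_eq_neg (hd : 0 < d) (hl : 0 < l) {b : Hilb (V × Coin d)}
    (hb : coinQuery d l m b = -b) (hloop : ∀ x, b (x, none) = 0) (x : V) :
    ∑ i : Fin d, b (x, some i) = 0 := by
  have hd' : (0 : ℝ) < d := by exact_mod_cast hd
  have hD : Real.sqrt (d + l) ≠ 0 := (Real.sqrt_pos.2 (by linarith)).ne'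
  have hval : ∀ e, (if x = m then (-1 : ℂ) else 1)
      * (2 * coinAmp d l e * (∑ e', (coinAmp d l e' : ℂ) * b (x, e')) - b (x, e))
      = -b (x, e) := by
    intro e
    rw [← coinQuery_apply, hb, PiLp.neg_apply]
  have hs : ∑ e', (coinAmp d l e' : ℂ) * b (x, e')
      = ((1 / Real.sqrt (d + l) : ℝ) : ℂ) * ∑ i : Fin d, b (x, some i) := by
    rw [Fintype.sum_option, hloop, mul_zero, zero_add, Finset.mul_sum]
    rfl
  have h0 : (coinAmp d l none : ℂ) * ∑ e', (coinAmp d l e' : ℂ) * b (x, e') = 0 := by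
    have h1 := hval none
    rw [hloop, sub_zero, neg_zero] at h1
    have h2 : (if x = m then (-1 : ℂ) else 1) ≠ 0 := by split_ifs <;> norm_num
    rw [mul_assoc] at h1
    exact (mul_eq_zero.1 ((mul_eq_zero.1 h1).resolve_left h2)).resolve_left two_ne_zero
  have h3 : (coinAmp d l none : ℂ) ≠ 0 :=
    Complex.ofReal_ne_zero.2 (div_ne_zero (Real.sqrt_pos.2 hl).ne' hD)
  have h4 := (mul_eq_zero.1 h0).resolve_left h3
  rw [hs] at h4
  exact (mul_eq_zero.1 h4).resolve_left (Complex.ofReal_ne_zero.2 (one_div_ne_zero hD))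

end Operators

/-! ### The lackadaisical quantum walk -/

section Lackadaisical

variable {V : Type*} [Fintype V] [DecidableEq V] {G : SimpleGraph V} [DecidableRel G.Adj]
  {d : ℕ} {m : V} {h : V → ℝ}

/-- As for the interpolated walk, the current is a multiple of the gradient of the hitting times.
Here the loop at `m` has weight in the coin state but carries no current, and the sources can only
be matched at `m` if the same current arrives on each of its arcs, which is the hypothesis `hN`. -/
theorem cotQHT_lackadaisicalWalk_sq [Nontrivial V] (hd0 : 0 < d)
    (hh : IsHittingPotential G d m h)
    (hN : ∀ y, G.Adj m y → h y = (Fintype.card V : ℝ) - 1)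
    (nbr : (x : V) → Fin d ≃ G.neighborSet x) {l : ℝ}
    (hl : l = (d : ℝ) / (Fintype.card V : ℝ)) :
    cotQHT (lackadaisicalWalk nbr l m) (lackadaisicalInit d l m) ^ 2
      = 2 * (Fintype.card V : ℝ) * ((Fintype.card V : ℝ) + 1)
          / ((2 * (Fintype.card V : ℝ) - 1) ^ 2 * ((Fintype.card V : ℝ) - 1)) * ∑ x, h x
        - (Fintype.card V : ℝ) / (2 * (Fintype.card V : ℝ) - 1) := by
  set N : ℝ := (Fintype.card V : ℝ) with hNdef
  have hN1 : 1 < N := by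
    rw [hNdef]; exact_mod_cast Fintype.one_lt_card (α := V)
  have hd' : (0 : ℝ) < d := by exact_mod_cast hd0
  have hl0 : 0 < l := by rw [hl]; exact div_pos hd' (by linarith)
  have hdl : l * N = d := by rw [hl]; field_simp
  set D := Real.sqrt (d + l) with hDdef
  set q := Real.sqrt l with hq
  set p := Real.sqrt (N - 1) with hp
  have hD2 : D ^ 2 = l * (N + 1) := by
    rw [hDdef, Real.sq_sqrt (by linarith), ← hdl]; ring
  have hq2 : q ^ 2 = l := Real.sq_sqrt hl0.le
  have hp2 : p ^ 2 = N - 1 := Real.sq_sqrt (by linarith)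
  have hD0 : 0 < D := Real.sqrt_pos.2 (by linarith)
  have hq0 : 0 < q := Real.sqrt_pos.2 hl0
  have hp0 : 0 < p := Real.sqrt_pos.2 (by linarith)
  have hM0 : 0 < 2 * N - 1 := by linarith
  have hM0' : N * 2 - 1 ≠ 0 := by linarith
  have hN0 : N - 1 ≠ 0 := by linarith
  have hsome : ∀ i, coinAmp d l (some i) = 1 / D := fun _ => rfl
  have hnone : coinAmp d l none = q / D := rfl
  -- `w₀` is the projection of the initial state to the vectors fixed by both reflections, which
  -- are constant on the arcs and orthogonal to the coin state at `m`.
  let κ : ℝ := p / (D * (2 * N - 1))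
  let t : ℝ := N / ((2 * N - 1) * p)
  let w₀ : V × Coin d → ℝ := fun z => match z with
    | (_, some _) => κ
    | (x, none) => κ * if x = m then -(d / q) else q
  let w₁ : V × Coin d → ℝ := fun z => if z.1 = m then -w₀ z else t * coinAmp d l z.2
  -- `β` matches the source `d` of the potential to the amplitude `t` at unmarked vertices.
  let β : ℝ := D * N / (d * (2 * N - 1) * p)
  let F : V × Coin d → ℝ := fun z => match z with
    | (x, some i) => β * (h x - h (nbr x i))
    | (_, none) => 0
  have hw₀ : ∀ x, x ≠ m → ∀ e, w₀ (x, e) = κ * D * coinAmp d l e := by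
    intro x hx e
    cases e with
    | some i =>
      rw [hsome]
      change κ = _
      field_simp
    | none =>
      rw [hnone]
      change (κ * if x = m then -(d / q) else q) = _
      rw [if_neg hx]
      field_simp
  have hw₀m : ∑ e, coinAmp d l e * w₀ (m, e) = 0 := by
    rw [Fintype.sum_option, hnone]
    simp only [hsome, w₀, if_true, Finset.sum_const, Finset.card_univ, Fintype.card_fin,
      nsmul_eq_mul]
    field_simp
    ring
  have hinit : lackadaisicalInit d l m = realVec w₀ + realVec w₁ := by
    have hc : 1 / p = κ * D + t := by
      simp only [κ, t]
      field_simp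
      rw [hp2]; ring
    ext ⟨x, e⟩
    have h1 : lackadaisicalInit d l m (x, e)
        = ((1 / p : ℝ) : ℂ) * if x = m then 0 else (coinAmp d l e : ℂ) := by
      rw [lackadaisicalInit, coinState_eq, PiLp.smul_apply, smul_eq_mul]
      congr 1
      by_cases hx : x = m
      · simp [tens_apply, ket_apply, Finset.sum_ite_eq, hx]
      · simp [tens_apply, ket_apply, Finset.sum_ite_eq, hx]
    rw [h1, PiLp.add_apply, realVec_apply, realVec_apply, ← Complex.ofReal_add]
    by_cases hx : x = m
    · simp [w₁, hx]
    · simp only [w₁, if_neg hx]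
      rw [hw₀ x hx, hc]
      push_cast
      ring
  have hS : shiftOp nbr = Matrix.of fun p q => if p = flipArc nbr q then (1 : ℂ) else 0 := rfl
  have hflip := flipArc_involutive nbr
  rw [hinit, lackadaisicalWalk_eq, hS, cotQHT_sq_eq_energy (g := realVec F)
    (norm_toEuclideanLin_involution hflip) (norm_coinQuery hd0 hl0.le)
    (fun b => by ext z; rw [toEuclideanLin_involution_apply hflip,
      toEuclideanLin_involution_apply hflip, hflip z]) (coinQuery_coinQuery hd0 hl0.le)
    ?_ (coinQuery_eq_self hd0 hl0.le (t := fun _ => κ * D) hw₀ hw₀m)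
    (coinQuery_eq_self hd0 hl0.le (t := fun _ => t) (fun x hx e => if_neg hx) ?_) ?_ ?_ ?_]
  · have hF : ‖realVec F‖ ^ 2 = β ^ 2 * (2 * (d * ∑ x, h x)) := by
      rw [norm_sq_realVec, Fintype.sum_prod_type, ← hh.energy, Finset.mul_sum]
      refine Finset.sum_congr rfl fun x _ => ?_
      rw [Fintype.sum_option, ← sum_nbr nbr x fun y => (h x - h y) ^ 2, Finset.mul_sum]
      simp only [F, mul_pow]
      ring
    have hw : ‖realVec w₁‖ ^ 2 = N / (2 * N - 1) := by
      have hm : ∑ e, w₁ (m, e) ^ 2 = κ ^ 2 * (d + (d / q) ^ 2) := by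
        rw [Fintype.sum_option]
        simp only [w₁, w₀, if_true, Finset.sum_const, Finset.card_univ, Fintype.card_fin,
          nsmul_eq_mul]
        ring
      have hx : ∀ x ∈ Finset.univ.erase m, ∑ e, w₁ (x, e) ^ 2 = t ^ 2 := by
        intro x hx
        simp only [w₁, if_neg (Finset.ne_of_mem_erase hx), mul_pow, ← Finset.mul_sum,
          sum_coinAmp_sq hd0 hl0.le, mul_one]
      rw [norm_sq_realVec, Fintype.sum_prod_type, ← Finset.add_sum_erase _ _ (Finset.mem_univ m),
        hm, Finset.sum_congr rfl hx, Finset.sum_const,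
        Finset.card_erase_of_mem (Finset.mem_univ m), Finset.card_univ, nsmul_eq_mul,
        Nat.cast_sub Fintype.card_pos, ← hNdef]
      push_cast
      simp only [κ, t, div_pow, mul_pow, hp2, hq2, hD2]
      rw [← hdl]
      field_simp
      ring
    rw [hF, hw]
    congr 1
    simp only [β, div_pow, mul_pow, hp2, hD2]
    rw [← hdl]
    field_simp
  · ext ⟨x, _ | i⟩
    · rw [toEuclideanLin_involution_apply hflip]
      rfl
    · rw [toEuclideanLin_involution_apply hflip]
      rfl
  · simp only [w₁, if_true, mul_neg, Finset.sum_neg_distrib, hw₀m, neg_zero]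
  · ext ⟨x, _ | i⟩
    · rw [toEuclideanLin_involution_apply hflip, PiLp.neg_apply]
      simp [F, flipArc]
    · obtain ⟨j, hj, hij⟩ := exists_flipArc_eq nbr x i
      rw [toEuclideanLin_involution_apply hflip, PiLp.neg_apply, hij, realVec_apply,
        realVec_apply, ← Complex.ofReal_neg]
      congr 1
      simp only [F, hj]
      ring
  · have hsub : realVec F - realVec w₁ = realVec fun z => F z - w₁ z := by
      ext z
      simp
    rw [hsub]
    refine coinQuery_eq_neg hd0 hl0.le (t := -(κ * N * D)) (fun x hx => ?_) fun e => ?_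
    · simp only [mul_sub, Finset.sum_sub_distrib, w₁, if_neg hx]
      have h1 : ∑ e, coinAmp d l e * F (x, e) = β * d / D := by
        rw [Fintype.sum_option]
        simp only [F, hsome, mul_zero, zero_add, ← Finset.mul_sum]
        rw [sum_nbr nbr x fun y => h x - h y, hh.unmarked x hx]
        field_simp
      have h2 : ∑ e, coinAmp d l e * (t * coinAmp d l e) = t := by
        conv_rhs => rw [← mul_one t, ← sum_coinAmp_sq hd0 hl0.le, Finset.mul_sum]
        exact Finset.sum_congr rfl fun e _ => by ring
      rw [h1, h2]
      simp only [β, t]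
      field_simp
      ring
    · cases e with
      | some i =>
        simp only [F, w₁, w₀, if_true, hh.marked, hN _ (nbr m i).2, hsome]
        simp only [β, κ]
        rw [← hp2, ← hdl]
        field_simp
        rw [hD2, hp2]
        ring
      | none =>
        simp only [F, w₁, w₀, if_true, hnone]
        rw [← hdl, ← hq2]
        field_simp
        ring
  · intro b hbS hbR
    have hloop : ∀ x, b (x, none) = 0 := by
      intro x
      have h1 := toEuclideanLin_involution_apply hflip b (x, none)
      rw [hbS, PiLp.neg_apply] at h1
      exact self_eq_neg.1 h1.symm
    let k : V → V → ℂ := fun x y =>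
      if hxy : G.Adj x y then (starRingEnd ℂ) (b (x, some ((nbr x).symm ⟨y, hxy⟩))) else 0
    have hk : ∀ x i, k x (nbr x i) = (starRingEnd ℂ) (b (x, some i)) := by
      intro x i
      have hadj : G.Adj x (nbr x i) := (nbr x i).2
      simp only [k, dif_pos hadj]
      rw [show (⟨(nbr x i : V), hadj⟩ : G.neighborSet x) = nbr x i from rfl,
        Equiv.symm_apply_apply]
    have hanti : ∀ x y, G.Adj x y → k y x = -k x y := by
      intro x y hxy
      obtain ⟨i, hi⟩ := (nbr x).surjective ⟨y, hxy⟩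
      have hiy : (nbr x i : V) = y := congrArg Subtype.val hi
      obtain ⟨j, hj, hij⟩ := exists_flipArc_eq nbr x i
      have h1 := toEuclideanLin_involution_apply hflip b (x, some i)
      rw [hbS, PiLp.neg_apply, hij] at h1
      subst hiy
      have h2 := hk (nbr x i) j
      rw [hj] at h2
      rw [h2, hk, ← h1, map_neg]
    have h0 := circulation_mul_gradient_eq_zero hanti (fun x => by
      rw [← sum_nbr nbr x fun y => k x y]
      simp only [hk]
      rw [← map_sum, divergence_eq_zero_of_coinQuery_eq_neg hd0 hl0 hbR hloop, map_zero])
      fun x => (h x : ℂ)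
    rw [inner_realVec, Fintype.sum_prod_type, ← mul_zero (β : ℂ), ← h0, Finset.mul_sum]
    refine Finset.sum_congr rfl fun x _ => ?_
    rw [← sum_nbr nbr x fun y => k x y * ((h x : ℂ) - h y), Finset.mul_sum, Fintype.sum_option]
    simp only [F, hk, Complex.ofReal_zero, mul_zero, zero_add]
    refine Finset.sum_congr rfl fun i _ => ?_
    push_cast
    ring

end Lackadaisical

end QWalk

end

theorem theorem2 :
    ∃ C : ℝ, 0 < C ∧
      ∀ (V : Type*) [Fintype V] [DecidableEq V] [Nontrivial V]
        (G : SimpleGraph V) [DecidableRel G.Adj] (d : ℕ) (m : V)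
        (nbr : (x : V) → Fin d ≃ G.neighborSet x) (l s : ℝ),
        G.Connected → G.IsRegularOfDegree d → QWalk.LocallyArcTransitive G →
        l = (d : ℝ) / (Fintype.card V : ℝ) → s = 1 - l / (d : ℝ) →
        QWalk.cotQHT (QWalk.lackadaisicalWalk nbr l m) (QWalk.lackadaisicalInit d l m) ^ 2
            = ((Fintype.card V : ℝ) + 1) / (Fintype.card V : ℝ)
                * QWalk.cotQHT (QWalk.interpolatedWalk (QWalk.randomWalk G) m s)
                    (QWalk.interpolatedInit (QWalk.randomWalk G) m s) ^ 2
              + 1 / (2 * (Fintype.card V : ℝ) - 1) ∧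
        QWalk.hittingTime (QWalk.randomWalk G) m ≠ ⊤ ∧
        QWalk.cotQHT (QWalk.interpolatedWalk (QWalk.randomWalk G) m s)
            (QWalk.interpolatedInit (QWalk.randomWalk G) m s)
          ≤ C * Real.sqrt (QWalk.hittingTime (QWalk.randomWalk G) m).toReal := by
  refine ⟨1, one_pos, ?_⟩
  intro V _ _ _ G _ d m nbr l s hG hd hA hl hs
  have hd0 : 0 < d := by
    rw [← hd m]
    exact hG.preconnected.degree_pos_of_nontrivial m
  have hd' : (d : ℝ) ≠ 0 := by exact_mod_cast hd0.ne'
  have hN1 : (1 : ℝ) < Fintype.card V := by exact_mod_cast Fintype.one_lt_card (α := V)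
  obtain ⟨h, hh⟩ := QWalk.exists_isHittingPotential hG d m
  have hs' : s = 1 - 1 / (Fintype.card V : ℝ) := by
    rw [hs, hl]; field_simp
  have hI := QWalk.cotQHT_interpolatedWalk_sq hd0 hd hh hs'
  have hT := QWalk.hittingTime_randomWalk_eq hd0 hd hh
  have hsum : 0 ≤ ∑ x, h x := Finset.sum_nonneg fun x _ => hh.nonneg hd0 x
  refine ⟨?_, ?_, ?_⟩
  · rw [QWalk.cotQHT_lackadaisicalWalk_sq hd0 hh (fun y hy => hh.eq_of_adj hG hd hA hy) nbr hl, hI]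
    generalize (Fintype.card V : ℝ) = N at hN1
    have h1 : N - 1 ≠ 0 := by linarith
    have h2 : N * 2 - 1 ≠ 0 := by linarith
    field_simp
    ring
  · rw [hT]
    exact ENNReal.ofReal_ne_top
  · rw [hT, one_mul, ENNReal.toReal_ofReal (div_nonneg hsum (by linarith))]
    refine Real.le_sqrt_of_sq_le ?_
    rw [hI]
    have hN2 : (2 : ℝ) ≤ Fintype.card V := by exact_mod_cast Fintype.one_lt_card (α := V)
    generalize (Fintype.card V : ℝ) = N at hN1 hN2
    generalize ∑ x, h x = H at hsum
    have h1 : 0 < N - 1 := by linarith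
    have h2 : 0 < 2 * N - 1 := by linarith
    have h3 : 0 ≤ N / (2 * N - 1) := div_nonneg (by linarith) h2.le
    have h4 : 2 * N ^ 2 / ((2 * N - 1) ^ 2 * (N - 1)) * H
        = 2 * N ^ 2 / (2 * N - 1) ^ 2 * (H / (N - 1)) := by
      rw [div_mul_div_comm, div_mul_eq_mul_div]
    have h5 : 2 * N ^ 2 / (2 * N - 1) ^ 2 ≤ 1 := by
      rw [div_le_one (by positivity)]
      nlinarith
    have h6 := mul_le_of_le_one_left (div_nonneg hsum h1.le) h5
    rw [h4]
    linarith
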